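/- Let $n\ge 1$ and let $\Gamma\subsetneq\mathbb{R}^n$ be an open, convex cone with vertex at the origin, invariant under permutations of the coordinates, such that $\Gamma_n\subseteq\Gamma\subseteq\Gamma_1$, where $\Gamma_k=\{x\in\mathbb{R}^n:\sigma_1(x)>0,\dots,\sigma_k(x)>0\}$ and $\sigma_k$ is the $k$-th elementary symmetric polynomial. Let $f:\overline{\Gamma}\to[0,\infty)$ be continuous, symmetric and concave, with $f>0$ on $\Gamma$, $f=0$ on $\partial\Gamma$, and $f$ strictly increasing in each variable on $\Gamma$. Let $M(\Gamma,n)$ be the set of $n\times n$ Hermitian matrices whose vector of eigenvalues $\lambda(H)$ lies in $\Gamma$, and for a Hermitian matrix $H$ put $F(H)=f(\lambda(H))$ if $H\in\overline{M(\Gamma,n)}$ and $F(H)=-\infty$ otherwise. For a real $C^2$ function $q$, let $Hq=\left(\frac{\partial^2 q}{\partial z_\alpha\partial\bar z_\beta}\right)_{\alpha,\beta}$ be its complex Hessian. Let $\Omega\subset\mathbb{C}^n$ be a bounded domain and $\psi:\overline{\Omega}\to[0,\infty)$ a continuous function such that $$\lim_{R\to\infty}f(R,\dots,R)>\sup_{\Omega}\psi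 ,$$ where the limit may be $+\infty$. Let $u:\Omega\to[-\infty,\infty)$ be upper semicontinuous. Then the following are equivalent. (a) $u$ is a viscosity subsolution of $F(Hu)=\psi(z)$ in $\Omega$: for every $z_0\in\Omega$ and every real function $q$ which is $C^2$ in a neighbourhood of $z_0$ and satisfies $q(z_0)=u(z_0)$ and $u\le q$ near $z_0$, one has $F(Hq(z_0))\ge\psi(z_0)$. (b) For every open set $U$ with compact closure contained in $\Omega$ there is a decreasing (that is, $u_{j+1}\le u_j$) sequence $(u_j)$ of real $C^\infty$ functions on $U$, converging pointwise to $u$ on $U$, such that for every $j$ and every $z\in U$, $Hu_j(z)\in M(\Gamma,n)$ (i.e. $u_j$ is $\Gamma$-subharmonic) and $F(Hu_j(z))\ge\psi(z)$. -/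

import Mathlib

open Set Filter Topology
open scoped ContDiff

/-- `k`-th elementary symmetric sum of the coordinates of `x ∈ ℝⁿ`. -/
def elemSymm {n : ℕ} (k : ℕ) (x : Fin n → ℝ) : ℝ :=
  ∑ s ∈ (Finset.univ : Finset (Fin n)).powersetCard k, ∏ j ∈ s, x j

/-- The cone `Γ_k = {x ∈ ℝⁿ : σ₁(x) > 0, …, σ_k(x) > 0}`. -/
def sigmaCone (n k : ℕ) : Set (Fin n → ℝ) :=
  {x | ∀ i, 1 ≤ i → i ≤ k → 0 < elemSymm i x}

/-- `Γ ⊊ ℝⁿ` is an open, convex, symmetric cone with vertex at the origin and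
`Γ_n ⊆ Γ ⊆ Γ₁`. -/
structure IsAdmissibleCone {n : ℕ} (Γ : Set (Fin n → ℝ)) : Prop where
  ne_univ : Γ ≠ univ
  isOpen : IsOpen Γ
  convex : Convex ℝ Γ
  symmetric : ∀ x ∈ Γ, ∀ σ : Equiv.Perm (Fin n), x ∘ σ ∈ Γ
  cone : ∀ x ∈ Γ, ∀ t : ℝ, 0 < t → t • x ∈ Γ
  sigmaCone_subset : sigmaCone n n ⊆ Γ
  subset_sigmaCone : Γ ⊆ sigmaCone n 1

/-- The structural conditions on `f : closure Γ → [0, ∞)`; only the values of `f` on `closure Γ`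
matter. Strict monotonicity is required on the open cone `Γ`: on `∂Γ`, where `f = 0`, it fails for
standard examples such as `(σ_n)^{1/n}`. -/
structure IsAdmissibleFunction {n : ℕ} (Γ : Set (Fin n → ℝ)) (f : (Fin n → ℝ) → ℝ) : Prop where
  continuousOn : ContinuousOn f (closure Γ)
  symmetric : ∀ x ∈ closure Γ, ∀ σ : Equiv.Perm (Fin n), f (x ∘ σ) = f x
  strictMono : ∀ x ∈ Γ, ∀ (i : Fin n) (t : ℝ), x i < t →
    Function.update x i t ∈ Γ → f x < f (Function.update x i t)
  concaveOn : ConcaveOn ℝ (closure Γ) f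
  pos : ∀ x ∈ Γ, 0 < f x
  zero_on_frontier : ∀ x ∈ frontier Γ, f x = 0

/-- `M(Γ, n)`: the Hermitian `n × n` matrices whose vector of eigenvalues lies in `Γ`. (`Γ` being
symmetric, the order in which the eigenvalues are listed is irrelevant.) -/
def coneMatrices {n : ℕ} (Γ : Set (Fin n → ℝ)) : Set (Matrix (Fin n) (Fin n) ℂ) :=
  {H | ∃ hH : H.IsHermitian, hH.eigenvalues ∈ Γ}

open Classical in
/-- The operator `F`, with values in `[-∞, ∞)`: `F(H) = f(λ(H))` if `H` belongs to the closure of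
`M(Γ, n)`, and `F(H) = -∞` otherwise. Every matrix in that closure is Hermitian; the first conjunct
only serves to make the eigenvalues available. -/
noncomputable def hessianOperator {n : ℕ} (Γ : Set (Fin n → ℝ)) (f : (Fin n → ℝ) → ℝ)
    (H : Matrix (Fin n) (Fin n) ℂ) : EReal :=
  if h : H.IsHermitian ∧ H ∈ closure (coneMatrices Γ) then ((f h.1.eigenvalues : ℝ) : EReal) else ⊥

/-- The complex Hessian `(∂²q / ∂z_j ∂z̄_k)(z)` of a real function `q` on `ℂⁿ`. With `z_j = x_j + i y_j`
the `(j, k)` entry is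
`¼ (q_{x_j x_k} + q_{y_j y_k} + i (q_{x_j y_k} - q_{y_j x_k}))`,
where the real second derivatives are taken in the directions `e_j`, `i e_j`. -/
noncomputable def complexHessian {n : ℕ} (q : EuclideanSpace ℂ (Fin n) → ℝ)
    (z : EuclideanSpace ℂ (Fin n)) : Matrix (Fin n) (Fin n) ℂ :=
  Matrix.of fun j k =>
    let D : EuclideanSpace ℂ (Fin n) → EuclideanSpace ℂ (Fin n) → ℝ :=
      fun v w => fderiv ℝ (fun p => fderiv ℝ q p) z v w
    let ex : Fin n → EuclideanSpace ℂ (Fin n) := fun l => EuclideanSpace.single l 1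
    let ey : Fin n → EuclideanSpace ℂ (Fin n) := fun l => EuclideanSpace.single l Complex.I
    (1 / 4 : ℂ) * (((D (ex j) (ex k) + D (ey j) (ey k) : ℝ) : ℂ)
      + Complex.I * ((D (ex j) (ey k) - D (ey j) (ex k) : ℝ) : ℂ))

/-- `q` is an upper test function for `u : Ω → [-∞, ∞)` at `z₀`: it is `C²` near `z₀`,
`u(z₀) = q(z₀)` and `u ≤ q` near `z₀`. -/
def IsUpperTestFunction {n : ℕ} (u : EuclideanSpace ℂ (Fin n) → EReal)
    (z₀ : EuclideanSpace ℂ (Fin n)) (q : EuclideanSpace ℂ (Fin n) → ℝ) : Prop :=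
  ContDiffAt ℝ 2 q z₀ ∧ u z₀ = (q z₀ : EReal) ∧ ∀ᶠ z in 𝓝 z₀, u z ≤ (q z : EReal)

/-- `u ∈ USC(Ω)`: upper semicontinuous with values in `[-∞, ∞)`. -/
def IsUSC {n : ℕ} (Ω : Set (EuclideanSpace ℂ (Fin n)))
    (u : EuclideanSpace ℂ (Fin n) → EReal) : Prop :=
  (∀ z ∈ Ω, u z ≠ ⊤) ∧ UpperSemicontinuousOn u Ω

/-- `u` is a viscosity subsolution of `F(Hu) = ψ(z, u)` in the open set `Ω`: `u ∈ USC(Ω)` and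
`F(Hq(z₀)) ≥ ψ(z₀, u(z₀))` for every `z₀ ∈ Ω` and every upper test function `q` for `u` at `z₀`
(for which `u(z₀) = q(z₀)`). -/
def IsViscositySubsolution {n : ℕ} (Γ : Set (Fin n → ℝ)) (f : (Fin n → ℝ) → ℝ)
    (Ω : Set (EuclideanSpace ℂ (Fin n))) (ψ : EuclideanSpace ℂ (Fin n) → ℝ → ℝ)
    (u : EuclideanSpace ℂ (Fin n) → EReal) : Prop :=
  IsUSC Ω u ∧ ∀ z₀ ∈ Ω, ∀ q : EuclideanSpace ℂ (Fin n) → ℝ, IsUpperTestFunction u z₀ q →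
    ((ψ z₀ (q z₀) : ℝ) : EReal) ≤ hessianOperator Γ f (complexHessian q z₀)

/-- `w` is a smooth `Γ`-subharmonic function on the open set `U`: it is `C^∞` on `U` and
`Hw(z) ∈ M(Γ, n)` for every `z ∈ U`. -/
def IsSmoothGammaSubharmonicOn {n : ℕ} (Γ : Set (Fin n → ℝ))
    (U : Set (EuclideanSpace ℂ (Fin n))) (w : EuclideanSpace ℂ (Fin n) → ℝ) : Prop :=
  ContDiffOn ℝ ∞ w U ∧ ∀ z ∈ U, complexHessian w z ∈ coneMatrices Γ

/-! For a fixed level `c`, the real Hessians `B` with `F(B) ≥ c` form a closed convex set that is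
stable under adding positive semidefinite forms. Convexity comes from the concavity of `f` and the
Schur–Horn description of eigenvalue conditions through diagonals of unitary conjugates
(`eigenvalues_mem_iff`). The equation thus becomes a convex constraint on the Hessian, and (a) asks
for this constraint in the viscosity sense.

From (a) to (b): `u` is replaced by its maximum with `R‖z‖² - j`, itself a subsolution when
`f(R,…,R) ≥ ψ`. A sup-convolution makes the result continuous and a convolution makes it smooth.
Both steps lose a little in the level because `ψ` varies. Adding `δ‖z‖²` repairs this loss: since
`f(R,…,R)` exceeds `sup ψ` for some `R`, concavity makes a shift by `δ(1,…,1)` gain a uniform amount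
(`exists_shift`). A further constant puts the approximant strictly above `u`, which leaves room for
the next one below it.

The heart is `hessian_convolution_mem`: mollification preserves a convex constraint in the viscosity
sense. By Hahn–Banach it suffices to treat half-spaces `Λ(D²v) ≥ s`, where `Λ` is nonnegative on
positive semidefinite forms and `Λ(I) > 0`. This linear inequality amounts to domination, on balls,
by solutions of the Dirichlet problem. Domination is a closed convex condition on the restriction to
the ball, so it passes to averages of translates. Polynomial data have polynomial solutions even if
`Λ` is degenerate, so no elliptic regularity is needed.

From (b) to (a): if `q` touches `u` from above at `z₀`, then `v_j - q - ε‖z - z₀‖²` has, for large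
`j`, a local maximum near `z₀`. The constraint passes from `v_j` to `q + ε‖z - z₀‖²` there, and
closedness gives the limit. -/

set_option linter.unusedSectionVars false

/-! ### Real Hessians and the second order condition at a maximum -/

section Hessian

variable {E : Type*} [NormedAddCommGroup E] [NormedSpace ℝ E]

/-- The real second derivative of `q` at `z`, as a bilinear form. -/
noncomputable def hessian (q : E → ℝ) (z : E) : E →L[ℝ] E →L[ℝ] ℝ :=
  fderiv ℝ (fun p => fderiv ℝ q p) z

/-- Symmetric positive semidefinite bilinear forms. -/
def PosSemidefForm (B : E →L[ℝ] E →L[ℝ] ℝ) : Prop :=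
  (∀ v w, B v w = B w v) ∧ ∀ v, 0 ≤ B v v

lemma ContDiffAt.eventually_differentiableAt_two {q : E → ℝ} {z : E} (hq : ContDiffAt ℝ 2 q z) :
    ∀ᶠ y in 𝓝 z, DifferentiableAt ℝ q y := by
  filter_upwards [hq.eventually (by simp)] with y hy
  exact hy.differentiableAt (by simp)

lemma ContDiffAt.differentiableAt_fderiv {q : E → ℝ} {z : E} (hq : ContDiffAt ℝ 2 q z) :
    DifferentiableAt ℝ (fun p => fderiv ℝ q p) z :=
  (hq.fderiv_right (m := 1) (by norm_num)).differentiableAt (by simp)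

lemma ContDiffAt.continuousAt_hessian {q : E → ℝ} {z : E} (hq : ContDiffAt ℝ 2 q z) :
    ContinuousAt (hessian q) z :=
  ((hq.fderiv_right (m := 1) (by norm_num)).fderiv_right (m := 0) (by norm_num)).continuousAt

lemma hessian_symm {q : E → ℝ} {z : E} (hq : ContDiffAt ℝ 2 q z) (v w : E) :
    hessian q z v w = hessian q z w v :=
  (hq.isSymmSndFDerivAt (by simp)) v w

lemma hessian_add {p q : E → ℝ} {z : E} (hp : ContDiffAt ℝ 2 p z) (hq : ContDiffAt ℝ 2 q z) :
    hessian (fun x => p x + q x) z = hessian p z + hessian q z := by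
  have : (fun y => fderiv ℝ (fun x => p x + q x) y) =ᶠ[𝓝 z]
      fun y => fderiv ℝ p y + fderiv ℝ q y := by
    filter_upwards [hp.eventually_differentiableAt_two, hq.eventually_differentiableAt_two]
      with y h1 h2
    exact fderiv_fun_add h1 h2
  rw [hessian, this.fderiv_eq]
  exact fderiv_fun_add hp.differentiableAt_fderiv hq.differentiableAt_fderiv

lemma hessian_const_mul {q : E → ℝ} {z : E} (hq : ContDiffAt ℝ 2 q z) (c : ℝ) :
    hessian (fun x => c * q x) z = c • hessian q z := by
  have : (fun y => fderiv ℝ (fun x => c * q x) y) =ᶠ[𝓝 z] fun y => c • fderiv ℝ q y := by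
    filter_upwards [hq.eventually_differentiableAt_two] with y h1
    exact fderiv_const_mul h1 c
  rw [hessian, this.fderiv_eq]
  exact fderiv_fun_const_smul hq.differentiableAt_fderiv c

lemma hessian_sub {p q : E → ℝ} {z : E} (hp : ContDiffAt ℝ 2 p z) (hq : ContDiffAt ℝ 2 q z) :
    hessian (fun x => p x - q x) z = hessian p z - hessian q z := by
  have h := hessian_add hp (contDiffAt_const.mul hq : ContDiffAt ℝ 2 (fun x => (-1 : ℝ) * q x) z)
  rw [hessian_const_mul hq] at h
  have h1 : (fun x => p x - q x) = fun x => p x + -1 * q x := by ext; ring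
  rw [h1, h]
  ext v w
  simp [sub_eq_add_neg]

lemma hessian_add_const (q : E → ℝ) (z : E) (c : ℝ) :
    hessian (fun x => q x + c) z = hessian q z := by
  simp only [hessian, fderiv_add_const]

lemma hessian_comp_add_right (q : E → ℝ) (z a : E) :
    hessian (fun x => q (x + a)) z = hessian q (z + a) := by
  simp only [hessian, fderiv_comp_add_right]

/-- The necessary second order condition at a local maximum. -/
lemma hessian_nonpos_of_isLocalMax {q : E → ℝ} {z : E} (hq : ContDiffAt ℝ 2 q z)
    (h : IsLocalMax q z) (v : E) : hessian q z v v ≤ 0 := by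
  by_contra! hpos
  have hline : ∀ t : ℝ, HasDerivAt (fun t : ℝ => z + t • v) v t := fun t => by
    simpa using ((hasDerivAt_id t).smul_const v).const_add z
  have hcont : Tendsto (fun t : ℝ => z + t • v) (𝓝 0) (𝓝 z) := by
    have := (hline 0).continuousAt.tendsto
    simpa using this
  have h1 : deriv (fun t : ℝ => q (z + t • v)) =ᶠ[𝓝 0] fun t => fderiv ℝ q (z + t • v) v := by
    filter_upwards [hcont.eventually hq.eventually_differentiableAt_two] with t ht
    exact (ht.hasFDerivAt.comp_hasDerivAt t (hline t)).deriv
  have h2 : deriv (deriv (fun t : ℝ => q (z + t • v))) 0 = hessian q z v v := by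
    rw [h1.deriv_eq]
    have hd : HasFDerivAt (fun p => fderiv ℝ q p) (hessian q z) (z + (0 : ℝ) • v) := by
      simpa [hessian] using hq.differentiableAt_fderiv.hasFDerivAt
    have := (hd.comp_hasDerivAt (0 : ℝ) (hline 0))
    exact (this.clm_apply (hasDerivAt_const (0 : ℝ) v)).deriv.trans (by simp)
  have hmax : IsLocalMax (fun t : ℝ => q (z + t • v)) 0 := by
    have : ∀ᶠ t in 𝓝 (0 : ℝ), q (z + t • v) ≤ q z := hcont.eventually h
    simpa [IsLocalMax, IsMaxFilter] using this
  -- A positive second derivative would make the maximum a minimum as well, so `q` would be constant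
  -- along the line near `z`.
  have hmin : IsLocalMin (fun t : ℝ => q (z + t • v)) 0 := by
    refine isLocalMin_of_deriv_deriv_pos (by rw [h2]; exact hpos) hmax.deriv_eq_zero ?_
    have : ContinuousAt q (z + (0 : ℝ) • v) := by simpa using hq.continuousAt
    exact ContinuousAt.comp (f := fun t : ℝ => z + t • v) this (hline 0).continuousAt
  have hconst : (fun t : ℝ => q (z + t • v)) =ᶠ[𝓝 0] fun _ => q (z + (0 : ℝ) • v) := by
    filter_upwards [hmax, hmin] with t h3 h4
    exact le_antisymm h3 h4
  have h3 : deriv (deriv (fun t : ℝ => q (z + t • v))) 0 = 0 := by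
    rw [(hconst.deriv).deriv_eq]
    simp
  linarith

lemma posSemidefForm_neg_hessian {q : E → ℝ} {z : E} (hq : ContDiffAt ℝ 2 q z)
    (h : IsLocalMax q z) : PosSemidefForm (-hessian q z) :=
  ⟨fun v w => by simp [hessian_symm hq v w], fun v => by
    simpa using hessian_nonpos_of_isLocalMax hq h v⟩

lemma continuousAdd_form : ContinuousAdd (E →L[ℝ] E →L[ℝ] ℝ) :=
  (inferInstance : IsTopologicalAddGroup (E →L[ℝ] E →L[ℝ] ℝ)).toContinuousAdd

lemma tendsto_hessian_add {q : E → ℝ} {z : E} (hq : ContDiffAt ℝ 2 q z)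
    (B : E →L[ℝ] E →L[ℝ] ℝ) : Tendsto (fun y => hessian q y + B) (𝓝 z) (𝓝 (hessian q z + B)) :=
  have : ContinuousAdd (E →L[ℝ] E →L[ℝ] ℝ) := continuousAdd_form
  hq.continuousAt_hessian.tendsto.add_const B

lemma tendsto_add_smul_form (A B : E →L[ℝ] E →L[ℝ] ℝ) :
    Tendsto (fun ε : ℝ => A + ε • B) (𝓝[>] 0) (𝓝 A) := by
  have : ContinuousAdd (E →L[ℝ] E →L[ℝ] ℝ) := continuousAdd_form
  have h := ((ContinuousLinearMap.toSpanSingleton ℝ B).continuous.tendsto 0).const_add A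
  have e : A + (ContinuousLinearMap.toSpanSingleton ℝ B) 0 = A := by ext x y; simp
  rw [e] at h
  exact h.mono_left nhdsWithin_le_nhds

end Hessian

/-! ### Polynomial functions on a finite-dimensional space -/

section PolyFun

variable {E : Type*} [NormedAddCommGroup E] [NormedSpace ℝ E] [FiniteDimensional ℝ E]
  {ι : Type*} [Fintype ι] (b : Module.Basis ι ℝ E)

/-- The coordinate functionals of a basis. -/
noncomputable def coordCLM (i : ι) : E →L[ℝ] ℝ := LinearMap.toContinuousLinearMap (b.coord i)

/-- The function on `E` given by a polynomial in the coordinates of `x - x₀`. -/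
noncomputable def polyFun (x₀ : E) (p : MvPolynomial ι ℝ) (x : E) : ℝ :=
  MvPolynomial.eval (fun i => coordCLM b i (x - x₀)) p

lemma polyFun_C (x₀ : E) (a : ℝ) (x : E) : polyFun b x₀ (MvPolynomial.C a) x = a := by
  simp [polyFun]

lemma polyFun_zero (x₀ x : E) : polyFun b x₀ 0 x = 0 := by simp [polyFun]

lemma polyFun_one (x₀ x : E) : polyFun b x₀ 1 x = 1 := by simp [polyFun]

lemma polyFun_X (x₀ : E) (i : ι) (x : E) :
    polyFun b x₀ (MvPolynomial.X i) x = coordCLM b i (x - x₀) := by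
  simp [polyFun]

lemma polyFun_add (x₀ : E) (p q : MvPolynomial ι ℝ) (x : E) :
    polyFun b x₀ (p + q) x = polyFun b x₀ p x + polyFun b x₀ q x := by
  simp [polyFun]

lemma polyFun_sub (x₀ : E) (p q : MvPolynomial ι ℝ) (x : E) :
    polyFun b x₀ (p - q) x = polyFun b x₀ p x - polyFun b x₀ q x := by
  simp [polyFun]

lemma polyFun_mul (x₀ : E) (p q : MvPolynomial ι ℝ) (x : E) :
    polyFun b x₀ (p * q) x = polyFun b x₀ p x * polyFun b x₀ q x := by
  simp [polyFun]

lemma polyFun_sum {κ : Type*} (s : Finset κ) (x₀ : E) (p : κ → MvPolynomial ι ℝ) (x : E) :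
    polyFun b x₀ (∑ k ∈ s, p k) x = ∑ k ∈ s, polyFun b x₀ (p k) x := by
  simp [polyFun]

lemma hasFDerivAt_polyFun (x₀ : E) (p : MvPolynomial ι ℝ) (x : E) :
    HasFDerivAt (polyFun b x₀ p)
      (∑ i, polyFun b x₀ (MvPolynomial.pderiv i p) x • coordCLM b i) x := by
  classical
  induction p using MvPolynomial.induction_on with
  | C a =>
    simp only [MvPolynomial.pderiv_C, polyFun_zero, zero_smul, Finset.sum_const_zero]
    rw [funext (polyFun_C b x₀ a)]
    exact hasFDerivAt_const a x
  | add p q hp hq =>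
    rw [funext (polyFun_add b x₀ p q)]
    refine (hp.fun_add hq).congr_fderiv ?_
    simp [polyFun_add, add_smul, Finset.sum_add_distrib]
  | mul_X p i hp =>
    have h1 : HasFDerivAt (polyFun b x₀ (MvPolynomial.X i)) (coordCLM b i) x := by
      rw [funext (polyFun_X b x₀ i)]
      exact (coordCLM b i).hasFDerivAt.comp x ((hasFDerivAt_id x).sub_const x₀)
    rw [funext (polyFun_mul b x₀ p (MvPolynomial.X i))]
    refine (hp.fun_mul h1).congr_fderiv ?_
    simp only [Derivation.leibniz, MvPolynomial.pderiv_X, smul_eq_mul, polyFun_mul, polyFun_add,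
      add_smul, Finset.sum_add_distrib, Finset.smul_sum, smul_smul]
    congr 1
    rw [Finset.sum_eq_single i]
    · simp [polyFun_one]
    · intro j _ hj; simp [hj.symm, polyFun_zero]
    · simp

lemma hasFDerivAt_fderiv_polyFun (x₀ : E) (p : MvPolynomial ι ℝ) (x : E) :
    HasFDerivAt (fun y => fderiv ℝ (polyFun b x₀ p) y)
      (∑ i, ∑ j, polyFun b x₀ (MvPolynomial.pderiv j (MvPolynomial.pderiv i p)) x •
        (coordCLM b j).smulRight (coordCLM b i)) x := by
  have : (fun y => fderiv ℝ (polyFun b x₀ p) y) = fun y =>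
      ∑ i, polyFun b x₀ (MvPolynomial.pderiv i p) y • coordCLM b i :=
    funext fun y => (hasFDerivAt_polyFun b x₀ p y).fderiv
  rw [this]
  refine HasFDerivAt.fun_sum fun i _ => ?_
  convert (hasFDerivAt_polyFun b x₀ (MvPolynomial.pderiv i p) x).smul_const (coordCLM b i) using 1
  ext v w
  simp [Finset.sum_mul, mul_assoc]

lemma hessian_polyFun (x₀ : E) (p : MvPolynomial ι ℝ) (x : E) :
    hessian (polyFun b x₀ p) x =
      ∑ i, ∑ j, polyFun b x₀ (MvPolynomial.pderiv j (MvPolynomial.pderiv i p)) x •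
        (coordCLM b j).smulRight (coordCLM b i) :=
  (hasFDerivAt_fderiv_polyFun b x₀ p x).fderiv

lemma analyticOnNhd_polyFun (x₀ : E) (p : MvPolynomial ι ℝ) :
    AnalyticOnNhd ℝ (polyFun b x₀ p) univ := by
  have := AnalyticOnNhd.aeval_mvPolynomial (𝕜 := ℝ) (A := ℝ) (B := ℝ)
    (f := fun (x : E) i => coordCLM b i (x - x₀)) (s := univ)
    (fun i => ((coordCLM b i).analyticOnNhd univ).comp
      (analyticOnNhd_id.sub analyticOnNhd_const) (mapsTo_univ _ _)) p
  exact this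

lemma contDiff_polyFun (x₀ : E) (p : MvPolynomial ι ℝ) {m : WithTop ℕ∞} :
    ContDiff ℝ m (polyFun b x₀ p) :=
  contDiffOn_univ.1 ((analyticOnNhd_polyFun b x₀ p).contDiffOn uniqueDiffOn_univ)

/-- The identity theorem for analytic functions; every coordinate vector is attained, so the
polynomial vanishes at all points. -/
lemma polyFun_eq_zero_of_eventually {x₀ y : E} {p : MvPolynomial ι ℝ}
    (h : ∀ᶠ x in 𝓝 y, polyFun b x₀ p x = 0) : p = 0 := by
  have h0 := (analyticOnNhd_polyFun b x₀ p).eqOn_zero_of_preconnected_of_eventuallyEq_zero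
    isPreconnected_univ (mem_univ y) h
  refine MvPolynomial.funext fun a => ?_
  have := h0 (mem_univ (x₀ + b.equivFun.symm a))
  have hc : (fun i => coordCLM b i (x₀ + b.equivFun.symm a - x₀)) = a := by
    ext i
    change b.equivFun (x₀ + b.equivFun.symm a - x₀) i = a i
    rw [add_sub_cancel_left, LinearEquiv.apply_symm_apply]
  rw [polyFun, hc] at this
  simpa using this

/-- The polynomial of the squared distance to the base point. -/
noncomputable def sqPoly (ι : Type*) [Fintype ι] : MvPolynomial ι ℝ := ∑ i, MvPolynomial.X i * MvPolynomial.X i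

/-- The Hessian of the squared norm. -/
noncomputable def sqForm : E →L[ℝ] E →L[ℝ] ℝ :=
  ∑ i, (2 : ℝ) • (coordCLM b i).smulRight (coordCLM b i)

variable {b}

lemma polyFun_sqPoly (hb : ∀ x, ‖x‖ ^ 2 = ∑ i, b.repr x i ^ 2) (x₀ x : E) :
    polyFun b x₀ (sqPoly ι) x = ‖x - x₀‖ ^ 2 := by
  rw [hb]; simp [polyFun, sqPoly, coordCLM, sq]

lemma contDiff_sq_norm_sub (hb : ∀ x, ‖x‖ ^ 2 = ∑ i, b.repr x i ^ 2) (x₀ : E) {m : WithTop ℕ∞} :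
    ContDiff ℝ m fun x : E => ‖x - x₀‖ ^ 2 := by
  rw [← funext (polyFun_sqPoly hb x₀)]
  exact contDiff_polyFun b x₀ _

lemma hessian_sq_norm_sub (hb : ∀ x, ‖x‖ ^ 2 = ∑ i, b.repr x i ^ 2) (x₀ x : E) :
    hessian (fun x => ‖x - x₀‖ ^ 2) x = sqForm b := by
  classical
  have hd : ∀ i j, MvPolynomial.pderiv j (MvPolynomial.pderiv i (sqPoly ι)) =
      if i = j then (MvPolynomial.C 2 : MvPolynomial ι ℝ) else 0 := fun i j => by
    have : MvPolynomial.pderiv i (sqPoly ι) =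
        MvPolynomial.C 2 * (MvPolynomial.X i : MvPolynomial ι ℝ) := by
      simp only [sqPoly, map_sum, MvPolynomial.pderiv_mul, MvPolynomial.pderiv_X, Pi.single_apply]
      rw [Finset.sum_eq_single i]
      · simp only [if_true, map_ofNat]; ring
      · intro k _ hk; simp [hk]
      · simp
    rw [this, MvPolynomial.pderiv_C_mul, MvPolynomial.pderiv_X, Pi.single_apply]
    split_ifs <;> simp
  rw [← funext (polyFun_sqPoly hb x₀), hessian_polyFun, sqForm]
  refine Finset.sum_congr rfl fun i _ => ?_
  rw [Finset.sum_eq_single i]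
  · rw [hd, if_pos rfl, polyFun_C]
  · intro j _ hj
    rw [hd, if_neg hj.symm, polyFun_zero]
    ext; simp
  · simp

lemma sqForm_apply_self (hb : ∀ x, ‖x‖ ^ 2 = ∑ i, b.repr x i ^ 2) (v : E) :
    sqForm b v v = 2 * ‖v‖ ^ 2 := by
  rw [hb, sqForm]
  simp [coordCLM, Finset.mul_sum, sq]

lemma sqForm_symm (v w : E) : sqForm b v w = sqForm b w v := by
  simp [sqForm, coordCLM, mul_comm]

end PolyFun

/-! ### Viscosity constraints on the Hessian -/

section ViscosityBasics

variable {E : Type*} [NormedAddCommGroup E] [NormedSpace ℝ E]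

/-- Every `C²` function touching `v` from above at a point of `O` has its Hessian in `𝒦`. -/
def HessianSubsolution (𝒦 : Set (E →L[ℝ] E →L[ℝ] ℝ)) (O : Set E) (v : E → ℝ) : Prop :=
  ∀ x ∈ O, ∀ q : E → ℝ, ContDiffAt ℝ 2 q x → v x = q x → (∀ᶠ y in 𝓝 x, v y ≤ q y) →
    hessian q x ∈ 𝒦

lemma HessianSubsolution.mono {𝒦 𝒦' : Set (E →L[ℝ] E →L[ℝ] ℝ)} {O O' : Set E} {v : E → ℝ}
    (h : HessianSubsolution 𝒦 O v) (hK : 𝒦 ⊆ 𝒦') (hO : O' ⊆ O) : HessianSubsolution 𝒦' O' v :=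
  fun x hx q h1 h2 h3 => hK (h x (hO hx) q h1 h2 h3)

lemma HessianSubsolution.comp_sub_right {𝒦 : Set (E →L[ℝ] E →L[ℝ] ℝ)} {O O' : Set E} {v : E → ℝ}
    (h : HessianSubsolution 𝒦 O v) (a : E) (hO : ∀ x ∈ O', x - a ∈ O) :
    HessianSubsolution 𝒦 O' fun x => v (x - a) := by
  intro x hx q h1 h2 h3
  have hx' : x - a + a = x := sub_add_cancel x a
  have key := h (x - a) (hO x hx) (fun y => q (y + a)) ?_ (by simp [h2]) ?_
  · rwa [hessian_comp_add_right, hx'] at key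
  · have : ContDiffAt ℝ 2 q (x - a + a) := by rwa [hx']
    exact this.comp (x - a) (contDiffAt_id.add contDiffAt_const)
  · have ht : Tendsto (fun y => y + a) (𝓝 (x - a)) (𝓝 x) := by
      have : Tendsto (fun y => y + a) (𝓝 (x - a)) (𝓝 (x - a + a)) :=
        (continuous_add_const a).continuousAt
      rwa [hx'] at this
    filter_upwards [ht.eventually h3] with y hy
    simpa using hy

lemma posSemidefForm_hessian_sub {p q : E → ℝ} {z : E} (hp : ContDiffAt ℝ 2 p z)
    (hq : ContDiffAt ℝ 2 q z) (h0 : p z = q z) (h : ∀ᶠ y in 𝓝 z, p y ≤ q y) :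
    PosSemidefForm (hessian q z - hessian p z) := by
  have := posSemidefForm_neg_hessian (hp.sub hq) (q := fun x => p x - q x) (z := z) (by
    filter_upwards [h] with y hy
    simp only [h0, sub_self]; linarith)
  have e : -(hessian p z - hessian q z) = hessian q z - hessian p z := by
    ext v w; simp
  rwa [hessian_sub hp hq, e] at this

/-- The maximum over the compact ball has to sit on the sphere. This serves the comparison arguments
directly and, by contraposition, produces interior maxima. -/
lemma le_of_forall_sphere_of_not_isLocalMax [ProperSpace E] {x₀ : E} {r : ℝ} {φ : E → ℝ}
    (hφ : ContinuousOn φ (Metric.closedBall x₀ r))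
    (hmax : ∀ x ∈ Metric.ball x₀ r, ¬ IsLocalMax φ x) {M : ℝ}
    (hM : ∀ x ∈ Metric.sphere x₀ r, φ x ≤ M) : ∀ x ∈ Metric.closedBall x₀ r, φ x ≤ M := by
  intro x hx
  obtain ⟨y, hy, hymax⟩ := (isCompact_closedBall x₀ r).exists_isMaxOn ⟨x, hx⟩ hφ
  rcases (Metric.mem_closedBall.1 hy).lt_or_eq with hlt | heq
  · exact absurd (hymax.isLocalMax (Filter.mem_of_superset
      (Metric.isOpen_ball.mem_nhds hlt) Metric.ball_subset_closedBall)) (hmax y hlt)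
  · exact (hymax hx).trans (hM y heq)

end ViscosityBasics

/-! ### Comparison and the Dirichlet problem for constant coefficient operators -/

section Dirichlet

variable {E : Type*} [NormedAddCommGroup E] [NormedSpace ℝ E] [FiniteDimensional ℝ E]
  {ι : Type*} [Fintype ι] {b : Module.Basis ι ℝ E} {Λ : (E →L[ℝ] E →L[ℝ] ℝ) →L[ℝ] ℝ}

omit [FiniteDimensional ℝ E] in
lemma apply_form_sub (A B : E →L[ℝ] E →L[ℝ] ℝ) : Λ (A - B) = Λ A - Λ B := map_sub Λ A B

omit [FiniteDimensional ℝ E] in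
lemma apply_form_add (A B : E →L[ℝ] E →L[ℝ] ℝ) : Λ (A + B) = Λ A + Λ B := map_add Λ A B

omit [FiniteDimensional ℝ E] in
lemma apply_form_neg (A : E →L[ℝ] E →L[ℝ] ℝ) : Λ (-A) = -Λ A := map_neg Λ A

omit [FiniteDimensional ℝ E] in
lemma apply_form_smul (c : ℝ) (A : E →L[ℝ] E →L[ℝ] ℝ) : Λ (c • A) = c * Λ A := map_smul Λ c A

/-- Viscosity comparison on a ball with a smooth solution of the linear equation. -/
lemma HessianSubsolution.le_of_sphere (hb : ∀ x, ‖x‖ ^ 2 = ∑ i, b.repr x i ^ 2)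
    (hI : 0 < Λ (sqForm b)) {x₀ : E} {r s M : ℝ} {v h : E → ℝ}
    (hv : ContinuousOn v (Metric.closedBall x₀ r))
    (hsub : HessianSubsolution {B | s ≤ Λ B} (Metric.ball x₀ r) v)
    (hh : ContDiff ℝ 2 h) (hLh : ∀ x ∈ Metric.ball x₀ r, Λ (hessian h x) ≤ s)
    (hM : ∀ x ∈ Metric.sphere x₀ r, v x ≤ h x + M) :
    ∀ x ∈ Metric.closedBall x₀ r, v x ≤ h x + M := by
  intro x hx
  have hN : ContDiff ℝ 2 fun x : E => ‖x - x₀‖ ^ 2 := contDiff_sq_norm_sub hb x₀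
  -- At an interior maximum of `v - h + ε‖· - x₀‖²`, the function `h - ε‖· - x₀‖²` plus a constant
  -- touches `v` from above, yet `Λ` of its Hessian is at most `s - ε Λ(sqForm b) < s`.
  have key : ∀ ε : ℝ, 0 < ε → v x ≤ h x + M + ε * r ^ 2 := by
    intro ε hε
    have := le_of_forall_sphere_of_not_isLocalMax (x₀ := x₀) (r := r)
      (φ := fun y => v y - h y + ε * ‖y - x₀‖ ^ 2) (M := M + ε * r ^ 2)
      ((hv.sub hh.continuous.continuousOn).add (hN.continuous.continuousOn.const_smul ε)) ?_ ?_ x hx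
    · have h2 : 0 ≤ ε * ‖x - x₀‖ ^ 2 := by positivity
      linarith
    · intro y hy hmax
      have hc : ContDiffAt ℝ 2 (fun z => ε * ‖z - x₀‖ ^ 2) y :=
        contDiffAt_const.mul hN.contDiffAt
      have h1 := hsub y hy
        (fun z => h z - ε * ‖z - x₀‖ ^ 2 + (v y - h y + ε * ‖y - x₀‖ ^ 2))
        ((hh.contDiffAt.sub hc).add contDiffAt_const) (by ring) (by
          filter_upwards [hmax] with z hz
          linarith)
      rw [mem_ofPred_eq, hessian_add_const, hessian_sub hh.contDiffAt hc,
        hessian_const_mul hN.contDiffAt, hessian_sq_norm_sub hb, apply_form_sub,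
        apply_form_smul] at h1
      have h2 := hLh y hy
      have := mul_pos hε hI
      linarith
    · intro y hy
      have h1 := hM y hy
      rw [mem_sphere_iff_norm.1 hy]
      linarith
  by_contra! hlt
  -- With this `ε` the error `ε r²` is at most half of the supposed excess.
  have := key ((v x - (h x + M)) / (2 * (r ^ 2 + 1))) (by apply div_pos <;> nlinarith)
  have h3 : (v x - (h x + M)) / (2 * (r ^ 2 + 1)) * r ^ 2 ≤ (v x - (h x + M)) / 2 := by
    rw [div_mul_eq_mul_div, div_le_div_iff₀ (by positivity) (by positivity)]
    nlinarith
  linarith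

/-- A smooth function with `Λ (D²h) ≥ s` is a subsolution. -/
lemma hessianSubsolution_of_contDiff (hΛ : ∀ P, PosSemidefForm P → 0 ≤ Λ P) {O : Set E} {s : ℝ}
    {h : E → ℝ} (hh : ContDiff ℝ 2 h) (hs : ∀ x ∈ O, s ≤ Λ (hessian h x)) :
    HessianSubsolution {B | s ≤ Λ B} O h := by
  intro x hx q h1 h2 h3
  have := hΛ _ (posSemidefForm_hessian_sub hh.contDiffAt h1 h2 h3)
  rw [apply_form_sub] at this
  exact (hs x hx).trans (by linarith)

variable (b Λ) in
/-- The constant coefficient operator `Λ (D² ·)` on polynomials. -/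
noncomputable def polyOperator : MvPolynomial ι ℝ →ₗ[ℝ] MvPolynomial ι ℝ :=
  ∑ i, ∑ j, Λ ((coordCLM b j).smulRight (coordCLM b i)) •
    ((MvPolynomial.pderiv j).toLinearMap ∘ₗ (MvPolynomial.pderiv i).toLinearMap)

lemma apply_hessian_polyFun (x₀ : E) (p : MvPolynomial ι ℝ) (x : E) :
    Λ (hessian (polyFun b x₀ p) x) = polyFun b x₀ (polyOperator b Λ p) x := by
  simp [hessian_polyFun, polyOperator, polyFun_sum, MvPolynomial.smul_eq_C_mul, polyFun_mul,
    polyFun_C, mul_comm]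

lemma totalDegree_pderiv_le (i : ι) (p : MvPolynomial ι ℝ) {d : ℕ} (h : p.totalDegree ≤ d + 1) :
    (MvPolynomial.pderiv i p).totalDegree ≤ d := by
  classical
  rw [MvPolynomial.totalDegree, Finset.sup_le_iff]
  intro m hm
  rw [MvPolynomial.mem_support_iff, MvPolynomial.coeff_pderiv] at hm
  have h1 : m + Finsupp.single i 1 ∈ p.support :=
    MvPolynomial.mem_support_iff.2 (left_ne_zero_of_mul hm)
  have h2 := (MvPolynomial.le_totalDegree h1).trans h
  rw [Finsupp.sum_add_index' (by simp) (by simp), Finsupp.sum_single_index (by simp)] at h2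
  omega

lemma totalDegree_polyOperator_le (p : MvPolynomial ι ℝ) {d : ℕ} (h : p.totalDegree ≤ d + 2) :
    (polyOperator b Λ p).totalDegree ≤ d := by
  simp only [polyOperator, LinearMap.sum_apply, LinearMap.smul_apply]
  refine MvPolynomial.totalDegree_finsetSum_le fun i _ =>
    MvPolynomial.totalDegree_finsetSum_le fun j _ => ?_
  exact (MvPolynomial.totalDegree_smul_le _ _).trans
    (totalDegree_pderiv_le j _ (totalDegree_pderiv_le i p h))

/-- The Dirichlet problem with polynomial data on a sphere has a polynomial solution. -/
lemma exists_polynomial_dirichlet (hb : ∀ x, ‖x‖ ^ 2 = ∑ i, b.repr x i ^ 2)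
    (hΛ : ∀ P, PosSemidefForm P → 0 ≤ Λ P) (hI : 0 < Λ (sqForm b)) (x₀ : E) {r : ℝ} (hr : 0 < r)
    (g : MvPolynomial ι ℝ) (s : ℝ) :
    ∃ p : MvPolynomial ι ℝ, (∀ x, Λ (hessian (polyFun b x₀ p) x) = s) ∧
      ∀ x ∈ Metric.sphere x₀ r, polyFun b x₀ p x = polyFun b x₀ g x := by
  -- Fischer's argument: `κ` has degree at most 2 and vanishes on the sphere, so `q ↦ Λ(D²(κq))`
  -- maps polynomials of degree at most `d` to themselves. It is injective by comparison, hence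
  -- surjective, and subtracting a suitable `κq` corrects `g` without changing its boundary values.
  set κ : MvPolynomial ι ℝ := MvPolynomial.C (r ^ 2) - sqPoly ι with hκ
  have hκd : κ.totalDegree ≤ 2 := by
    refine (MvPolynomial.totalDegree_sub _ _).trans
      (max_le ((MvPolynomial.totalDegree_C _).le.trans (by norm_num)) ?_)
    refine MvPolynomial.totalDegree_finsetSum_le fun i _ => ?_
    exact (MvPolynomial.totalDegree_mul _ _).trans (by simp)
  have hκx : ∀ x, polyFun b x₀ κ x = r ^ 2 - ‖x - x₀‖ ^ 2 := fun x => by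
    rw [hκ, polyFun_sub, polyFun_C, polyFun_sqPoly hb]
  set d := (polyOperator b Λ g - MvPolynomial.C s).totalDegree with hd
  let T : MvPolynomial ι ℝ →ₗ[ℝ] MvPolynomial ι ℝ :=
    polyOperator b Λ ∘ₗ LinearMap.mulLeft ℝ κ
  have hT : ∀ q ∈ MvPolynomial.restrictTotalDegree ι ℝ d,
      T q ∈ MvPolynomial.restrictTotalDegree ι ℝ d := by
    intro q hq
    rw [MvPolynomial.mem_restrictTotalDegree] at hq ⊢
    refine totalDegree_polyOperator_le _ ?_
    refine (MvPolynomial.totalDegree_mul _ _).trans ?_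
    omega
  have hinj : Function.Injective (T.restrict hT) := by
    rw [← LinearMap.ker_eq_bot, LinearMap.ker_eq_bot']
    rintro ⟨q, hq⟩ hTq
    have hTq' : polyOperator b Λ (κ * q) = 0 := congrArg Subtype.val hTq
    have hle : ∀ p : MvPolynomial ι ℝ, polyOperator b Λ p = 0 →
        (∀ x ∈ Metric.sphere x₀ r, polyFun b x₀ p x = 0) →
        ∀ x ∈ Metric.closedBall x₀ r, polyFun b x₀ p x ≤ 0 := by
      intro p hp h0
      have hsm : ContDiff ℝ 2 (polyFun b x₀ p) := contDiff_polyFun b x₀ p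
      have := HessianSubsolution.le_of_sphere (Λ := Λ) hb hI (x₀ := x₀) (r := r) (s := 0) (M := 0)
        (v := polyFun b x₀ p) (h := fun _ => 0) hsm.continuous.continuousOn
        (hessianSubsolution_of_contDiff hΛ hsm fun x _ => by
          rw [apply_hessian_polyFun, hp, polyFun_zero]) contDiff_const
        (fun x _ => by simp [hessian]) (fun x hx => by simp [h0 x hx])
      simpa using this
    have hzero : ∀ x ∈ Metric.sphere x₀ r, polyFun b x₀ (κ * q) x = 0 := fun x hx => by
      rw [polyFun_mul, hκx, mem_sphere_iff_norm.1 hx, sub_self, zero_mul]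
    have hneg : ∀ x, polyFun b x₀ (-(κ * q)) x = -polyFun b x₀ (κ * q) x := fun x => by
      simp [polyFun]
    -- `κq` vanishes on the ball and `κ` is positive inside it.
    have hq0 : q = 0 := by
      refine polyFun_eq_zero_of_eventually b (x₀ := x₀) (y := x₀) ?_
      filter_upwards [Metric.ball_mem_nhds x₀ hr] with x hx
      have hx' := Metric.ball_subset_closedBall hx
      have h1 := hle _ hTq' hzero x hx'
      have h2 := hle (-(κ * q)) (by rw [map_neg, hTq', neg_zero])
        (fun y hy => by rw [hneg, hzero y hy, neg_zero]) x hx'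
      rw [hneg] at h2
      have h3 : polyFun b x₀ (κ * q) x = 0 := by linarith
      rw [polyFun_mul, hκx] at h3
      refine (mul_eq_zero.1 h3).resolve_left (ne_of_gt ?_)
      have := mem_ball_iff_norm.1 hx
      nlinarith [norm_nonneg (x - x₀)]
    simp [hq0]
  obtain ⟨⟨q, hq⟩, hTq⟩ := (LinearMap.injective_iff_surjective.1 hinj)
    ⟨polyOperator b Λ g - MvPolynomial.C s, (MvPolynomial.mem_restrictTotalDegree _ _ _).2 hd.ge⟩
  have hTq' : polyOperator b Λ (κ * q) = polyOperator b Λ g - MvPolynomial.C s :=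
    congrArg Subtype.val hTq
  refine ⟨g - κ * q, fun x => ?_, fun x hx => ?_⟩
  · rw [apply_hessian_polyFun, map_sub, hTq', sub_sub_cancel, polyFun_C]
  · rw [polyFun_sub, polyFun_mul, hκx, mem_sphere_iff_norm.1 hx, sub_self, zero_mul, sub_zero]

/-- Polynomials are uniformly dense in the continuous functions on a closed ball. -/
lemma exists_polyFun_near (b : Module.Basis ι ℝ E) (x₀ : E) (r : ℝ)
    (v : C(Metric.closedBall x₀ r, ℝ)) {η : ℝ} (hη : 0 < η) :
    ∃ g : MvPolynomial ι ℝ, ∀ x : Metric.closedBall x₀ r, |polyFun b x₀ g x - v x| < η := by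
  let coordMap : ι → C(Metric.closedBall x₀ r, ℝ) := fun i =>
    ⟨fun x => coordCLM b i ((x : E) - x₀), by fun_prop⟩
  let A : Subalgebra ℝ C(Metric.closedBall x₀ r, ℝ) := (MvPolynomial.aeval coordMap).range
  have hev : ∀ (p : MvPolynomial ι ℝ) (x : Metric.closedBall x₀ r),
      (MvPolynomial.aeval coordMap p) x = polyFun b x₀ p x := by
    intro p x
    induction p using MvPolynomial.induction_on with
    | C a => simp [polyFun]
    | add p q hp hq => simp [polyFun_add, hp, hq]
    | mul_X p i hp => rw [map_mul, MvPolynomial.aeval_X, ContinuousMap.mul_apply, hp, polyFun_mul, polyFun_X]; rfl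
  have hsep : A.SeparatesPoints := by
    intro x y hxy
    by_contra! hall
    refine hxy (Subtype.ext ?_)
    have h1 : ∀ i, b.repr ((x : E) - x₀) i = b.repr ((y : E) - x₀) i := fun i => by
      have := hall (fun z => coordMap i z) ⟨coordMap i, ⟨MvPolynomial.X i, by simp⟩, rfl⟩
      simpa [coordMap, coordCLM] using this
    have h2 := b.repr.injective (Finsupp.ext h1)
    simpa using h2
  have hdense := ContinuousMap.subalgebra_topologicalClosure_eq_top_of_separatesPoints A hsep
  have hv : v ∈ A.topologicalClosure := by rw [hdense]; trivial
  obtain ⟨w, ⟨g, hg⟩, hw⟩ := Metric.mem_closure_iff.1 hv η hη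
  refine ⟨g, fun x => ?_⟩
  have h1 := (ContinuousMap.dist_apply_le_dist (f := v) (g := w) x).trans_lt hw
  have hg' : w = MvPolynomial.aeval coordMap g := hg.symm
  rw [← hev, ← hg', abs_sub_comm]
  exact h1

end Dirichlet

/-! ### Mollification of viscosity subsolutions -/

section Mollification

open scoped Convolution

variable {E : Type*} [NormedAddCommGroup E] [NormedSpace ℝ E] [FiniteDimensional ℝ E]
  {ι : Type*} [Fintype ι] {b : Module.Basis ι ℝ E} {Λ : (E →L[ℝ] E →L[ℝ] ℝ) →L[ℝ] ℝ}

variable (Λ) in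
/-- Continuous functions on a closed ball which are dominated by the solution of the Dirichlet
problem for `Λ (D²h) = s` with the same boundary values. -/
def dirichletDominated (x₀ : E) (r s : ℝ) : Set C(Metric.closedBall x₀ r, ℝ) :=
  {w | ∀ η > 0, ∃ h : E → ℝ, ContDiff ℝ 2 h ∧ (∀ x, Λ (hessian h x) = s) ∧
    (∀ x : Metric.closedBall x₀ r, w x ≤ h x + η) ∧
    ∀ x : Metric.closedBall x₀ r, (x : E) ∈ Metric.sphere x₀ r → h x ≤ w x + η}

lemma convex_dirichletDominated (x₀ : E) (r s : ℝ) : Convex ℝ (dirichletDominated Λ x₀ r s) := by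
  intro v hv w hw α β hα hβ hαβ η hη
  obtain ⟨h, h1, h2, h3, h4⟩ := hv η hη
  obtain ⟨k, k1, k2, k3, k4⟩ := hw η hη
  have c1 : ContDiff ℝ 2 fun x => α * h x := contDiff_const.mul h1
  have c2 : ContDiff ℝ 2 fun x => β * k x := contDiff_const.mul k1
  refine ⟨fun x => α * h x + β * k x, c1.add c2, fun x => ?_, fun x => ?_, fun x hx => ?_⟩
  · rw [hessian_add c1.contDiffAt c2.contDiffAt, hessian_const_mul h1.contDiffAt,
      hessian_const_mul k1.contDiffAt, apply_form_add, apply_form_smul, apply_form_smul, h2, k2,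
      ← add_mul, hαβ, one_mul]
  · simp only [ContinuousMap.add_apply, ContinuousMap.smul_apply, smul_eq_mul]
    have e : η = α * η + β * η := by rw [← add_mul, hαβ, one_mul]
    have := mul_le_mul_of_nonneg_left (h3 x) hα
    have := mul_le_mul_of_nonneg_left (k3 x) hβ
    linarith
  · simp only [ContinuousMap.add_apply, ContinuousMap.smul_apply, smul_eq_mul]
    have e : η = α * η + β * η := by rw [← add_mul, hαβ, one_mul]
    have := mul_le_mul_of_nonneg_left (h4 x hx) hα
    have := mul_le_mul_of_nonneg_left (k4 x hx) hβ
    linarith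

/-- The slack `η` in the definition absorbs the uniform distance to a nearby member, so no limit of
the solutions `h` has to be taken. -/
lemma isClosed_dirichletDominated (x₀ : E) (r s : ℝ) :
    IsClosed (dirichletDominated Λ x₀ r s) := by
  refine isClosed_of_closure_subset fun w hw η hη => ?_
  obtain ⟨v, hv, hvw⟩ := Metric.mem_closure_iff.1 hw (η / 2) (by positivity)
  obtain ⟨h, h1, h2, h3, h4⟩ := hv (η / 2) (by positivity)
  have hd : ∀ x, |w x - v x| < η / 2 := fun x =>
    (ContinuousMap.dist_apply_le_dist (f := w) (g := v) x).trans_lt hvw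
  refine ⟨h, h1, h2, fun x => ?_, fun x hx => ?_⟩
  · have := abs_lt.1 (hd x); have := h3 x; linarith
  · have := abs_lt.1 (hd x); have := h4 x hx; linarith

/-- The Dirichlet problem is solved for a polynomial uniformly close to `v`; comparison carries the
estimate from the sphere to the ball. -/
lemma HessianSubsolution.mem_dirichletDominated (hb : ∀ x, ‖x‖ ^ 2 = ∑ i, b.repr x i ^ 2)
    (hΛ : ∀ P, PosSemidefForm P → 0 ≤ Λ P) (hI : 0 < Λ (sqForm b)) {x₀ : E} {r s : ℝ} (hr : 0 < r)
    {v : E → ℝ} (hv : Continuous v)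
    (hsub : HessianSubsolution {B | s ≤ Λ B} (Metric.ball x₀ r) v) :
    (⟨fun x : Metric.closedBall x₀ r => v x, by fun_prop⟩ : C(Metric.closedBall x₀ r, ℝ)) ∈
      dirichletDominated Λ x₀ r s := by
  intro η hη
  obtain ⟨g, hg⟩ := exists_polyFun_near b x₀ r ⟨fun x => v x, by fun_prop⟩ hη
  obtain ⟨p, hp, hpg⟩ := exists_polynomial_dirichlet hb hΛ hI x₀ hr g s
  have hg' : ∀ x ∈ Metric.sphere x₀ r, |polyFun b x₀ p x - v x| < η := fun x hx => by
    rw [hpg x hx]; exact hg ⟨x, Metric.sphere_subset_closedBall hx⟩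
  refine ⟨polyFun b x₀ p, contDiff_polyFun b x₀ p, hp, fun x => ?_, fun x hx => ?_⟩
  · refine hsub.le_of_sphere hb hI hv.continuousOn (contDiff_polyFun b x₀ p)
      (fun y _ => (hp y).le) (fun y hy => ?_) x x.2
    have := abs_lt.1 (hg' y hy); linarith
  · have := abs_lt.1 (hg' x hx)
    change polyFun b x₀ p x ≤ v x + η
    linarith

/-- The converse for `C²` functions. If `Λ(D²w) < s` at `x₀`, then on a small ball `h - w - c‖· -
x₀‖²` has no interior maximum. Its sphere bound gives `h - w ≤ -3cr²/4` at `x₀`, whereas domination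
gives `h - w ≥ -cr²/4`. -/
lemma le_apply_hessian_of_mem_dirichletDominated (hb : ∀ x, ‖x‖ ^ 2 = ∑ i, b.repr x i ^ 2)
    (hΛ : ∀ P, PosSemidefForm P → 0 ≤ Λ P) (hI : 0 < Λ (sqForm b)) {x₀ : E} {s R : ℝ} (hR : 0 < R)
    {w : E → ℝ} (hw : ContDiff ℝ 2 w)
    (hdom : ∀ r, 0 < r → r < R →
      (⟨fun x : Metric.closedBall x₀ r => w x, hw.continuous.comp continuous_subtype_val⟩ :
        C(Metric.closedBall x₀ r, ℝ)) ∈ dirichletDominated Λ x₀ r s) :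
    s ≤ Λ (hessian w x₀) := by
  by_contra! hlt
  obtain ⟨c, hc0, hc⟩ : ∃ c, 0 < c ∧ Λ (hessian w x₀) < s - c * Λ (sqForm b) := by
    refine ⟨(s - Λ (hessian w x₀)) / (2 * Λ (sqForm b)), by apply div_pos <;> linarith, ?_⟩
    rw [div_mul_eq_mul_div, mul_comm 2, ← div_div, mul_div_cancel_right₀ _ hI.ne']
    linarith
  have hcont : ContinuousAt (fun x => Λ (hessian w x)) x₀ :=
    Λ.continuous.continuousAt.comp hw.contDiffAt.continuousAt_hessian
  obtain ⟨ρ, hρ, hρlt⟩ := Metric.eventually_nhds_iff_ball.1 (hcont.eventually_lt_const hc)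
  set r := min ρ R / 2 with hr
  have hmin : 0 < min ρ R := lt_min hρ hR
  have hr0 : 0 < r := by positivity
  have hrρ : r < ρ := by have := min_le_left ρ R; linarith
  have hrR : r < R := by have := min_le_right ρ R; linarith
  have hN : ContDiff ℝ 2 fun x : E => ‖x - x₀‖ ^ 2 := contDiff_sq_norm_sub hb x₀
  obtain ⟨h, h1, h2, h3, h4⟩ := hdom r hr0 hrR (c * r ^ 2 / 4) (by positivity)
  have hN' : ContDiff ℝ 2 fun x : E => c * ‖x - x₀‖ ^ 2 := contDiff_const.mul hN
  have hmax := le_of_forall_sphere_of_not_isLocalMax (x₀ := x₀) (r := r)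
    (φ := fun y => h y - w y - c * ‖y - x₀‖ ^ 2) (M := c * r ^ 2 / 4 - c * r ^ 2)
    ((h1.continuous.sub hw.continuous).sub hN'.continuous).continuousOn ?_ ?_ x₀
    (Metric.mem_closedBall_self hr0.le)
  · have h5 := h3 ⟨x₀, Metric.mem_closedBall_self hr0.le⟩
    simp only [ContinuousMap.coe_mk] at h5
    simp only [sub_self, norm_zero, ne_eq, OfNat.ofNat_ne_zero, not_false_eq_true, zero_pow,
      mul_zero, sub_zero] at hmax
    have : 0 < c * r ^ 2 := by positivity
    linarith
  · intro y hy hloc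
    have := hΛ _ (posSemidefForm_neg_hessian ((h1.sub hw).sub hN').contDiffAt hloc)
    rw [hessian_sub (p := fun y => h y - w y) (h1.sub hw).contDiffAt hN'.contDiffAt,
      hessian_sub h1.contDiffAt hw.contDiffAt, hessian_const_mul hN.contDiffAt,
      hessian_sq_norm_sub hb, apply_form_neg, apply_form_sub, apply_form_sub,
      apply_form_smul, h2] at this
    have h5 := hρlt y (Metric.ball_subset_ball hrρ.le hy)
    linarith
  · intro y hy
    have h5 := h4 ⟨y, Metric.sphere_subset_closedBall hy⟩ hy
    simp only [ContinuousMap.coe_mk] at h5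
    rw [mem_sphere_iff_norm.1 hy]
    linarith

variable [MeasurableSpace E] [BorelSpace E] (μ : MeasureTheory.Measure E) [μ.IsAddHaarMeasure]

open MeasureTheory in
/-- A mollification is a mean of translates. -/
lemma convolution_mem_of_forall_mem (φ : ContDiffBump (0 : E)) {v w : E → ℝ} (hv : Continuous v)
    (hw : Continuous w) (hwv : ∀ x, w x = (φ.normed μ ⋆[ContinuousLinearMap.lsmul ℝ ℝ, μ] v) x)
    {S : Set E} [CompactSpace S] {D : Set C(S, ℝ)} (hD : Convex ℝ D) (hDc : IsClosed D)
    (hmem : ∀ y ∈ Metric.ball (0 : E) φ.rOut,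
      (⟨fun x : S => v (x - y), by fun_prop⟩ : C(S, ℝ)) ∈ D) :
    (⟨fun x : S => w x, by fun_prop⟩ : C(S, ℝ)) ∈ D := by
  -- `F` is the continuous curve of translates of `v`. Its Bochner integral against the probability
  -- measure with density `φ.normed μ` stays in the closed convex set `D`, and evaluation at points
  -- of `S` identifies it with `w`.
  let F : C(E, C(S, ℝ)) := ContinuousMap.curry ⟨fun p : E × S => v (p.2 - p.1), by fun_prop⟩
  set f : E → NNReal := fun y => Real.toNNReal (φ.normed μ y) with hf
  have hfm : Measurable f := (φ.continuous_normed (μ := μ)).measurable.real_toNNReal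
  have hfr : ∀ y, ((f y : NNReal) : ℝ) = φ.normed μ y := fun y =>
    Real.coe_toNNReal _ (φ.nonneg_normed y)
  set ν : Measure E := μ.withDensity fun y => (f y : ENNReal) with hν
  have hprob : IsProbabilityMeasure ν := by
    constructor
    rw [hν, withDensity_apply _ MeasurableSet.univ, Measure.restrict_univ]
    change ∫⁻ y, ENNReal.ofReal (φ.normed μ y) ∂μ = 1
    rw [← ofReal_integral_eq_lintegral_ofReal φ.integrable_normed
      (Eventually.of_forall fun y => φ.nonneg_normed y), φ.integral_normed, ENNReal.ofReal_one]
  have hint : Integrable (fun y => φ.normed μ y • F y) μ :=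
    (φ.continuous_normed.smul F.continuous).integrable_of_hasCompactSupport
      (φ.hasCompactSupport_normed.smul_right)
  have hint' : Integrable F ν := by
    rw [hν, integrable_withDensity_iff_integrable_smul hfm]
    refine hint.congr (Eventually.of_forall fun y => ?_)
    change φ.normed μ y • F y = (f y : ℝ) • F y
    rw [hfr]
  have hae : ∀ᵐ y ∂ν, F y ∈ D := by
    rw [hν, ae_withDensity_iff (by fun_prop)]
    refine Eventually.of_forall fun y hy => hmem y ?_
    rw [← φ.support_normed_eq (μ := μ)]
    intro h0
    exact hy (by simp [hf, h0])
  have hmain := hD.integral_mem hDc hae hint'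
  convert hmain using 1
  ext x
  have h1 : (∫ y, F y ∂ν) x = ∫ y, F y x ∂ν :=
    ((ContinuousMap.evalCLM ℝ x).integral_comp_comm hint').symm
  rw [h1, hν, integral_withDensity_eq_integral_smul hfm]
  change w x = ∫ y, (f y : ℝ) • F y x ∂μ
  rw [hwv]
  simp only [hfr]
  rfl

open MeasureTheory in
lemma contDiff_convolution_normed (φ : ContDiffBump (0 : E)) {v : E → ℝ} (hv : Continuous v) :
    ContDiff ℝ ∞ (φ.normed μ ⋆[ContinuousLinearMap.lsmul ℝ ℝ, μ] v) :=
  φ.hasCompactSupport_normed.contDiff_convolution_left _ φ.contDiff_normed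
    hv.locallyIntegrable

open MeasureTheory in
/-- Mollification preserves continuous viscosity subsolutions of a convex constraint on the
Hessian. -/
lemma HessianSubsolution.hessian_convolution_mem (hb : ∀ x, ‖x‖ ^ 2 = ∑ i, b.repr x i ^ 2)
    {𝒦 : Set (E →L[ℝ] E →L[ℝ] ℝ)} (hconv : Convex ℝ 𝒦) (hclosed : IsClosed 𝒦)
    (hpos : ∀ B ∈ 𝒦, ∀ P, PosSemidefForm P → B + P ∈ 𝒦) {R : ℝ} (hR : R • sqForm b ∈ 𝒦)
    {v : E → ℝ} (hv : Continuous v) {x₀ : E} {r : ℝ}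
    (hsub : HessianSubsolution 𝒦 (Metric.ball x₀ r) v) (φ : ContDiffBump (0 : E))
    (hφ : φ.rOut < r) :
    hessian (φ.normed μ ⋆[ContinuousLinearMap.lsmul ℝ ℝ, μ] v) x₀ ∈ 𝒦 := by
  set w := φ.normed μ ⋆[ContinuousLinearMap.lsmul ℝ ℝ, μ] v with hw_def
  have hw : ContDiff ℝ 2 w := contDiff_infty.1 (contDiff_convolution_normed μ φ hv) 2
  by_contra hnot
  obtain ⟨Λ, s, hlt, hge⟩ := geometric_hahn_banach_point_closed hconv hclosed hnot
  -- If `Λ P < 0`, adding a suitable multiple of `P` to `R • sqForm b` stays in `𝒦` but brings `Λ`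
  -- down to exactly `s`.
  have hΛ : ∀ P, PosSemidefForm P → 0 ≤ Λ P := by
    intro P hP
    by_contra! hneg
    have hPt : PosSemidefForm (((Λ (R • sqForm b) - s) / (-Λ P)) • P) := by
      have ht : 0 ≤ (Λ (R • sqForm b) - s) / (-Λ P) :=
        div_nonneg (by linarith [hge _ hR]) (by linarith)
      exact ⟨fun x y => by simp [hP.1 x y], fun x => by simpa using mul_nonneg ht (hP.2 x)⟩
    have := hge _ (hpos _ hR _ hPt)
    rw [apply_form_add, apply_form_smul _ P, div_neg, neg_mul, div_mul_cancel₀ _ hneg.ne] at this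
    linarith
  -- A large multiple of `sqForm b` added to the excluded Hessian lands in `𝒦`, moving `Λ` from
  -- below `s` to above it.
  have hI : 0 < Λ (sqForm b) := by
    set B := hessian w x₀ with hB
    set t := R + ‖B‖ / 2 with ht
    have hP : PosSemidefForm (B + (t - R) • sqForm b) := by
      refine ⟨fun x y => ?_, fun x => ?_⟩
      · simp [sqForm_symm x y, hB, hessian_symm hw.contDiffAt x y]
      · have h1 : |B x x| ≤ ‖B‖ * ‖x‖ * ‖x‖ := B.le_opNorm₂ x x
        have h2 := (abs_le.1 h1).1
        simp only [add_apply, smul_apply, smul_eq_mul,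
          sqForm_apply_self hb, ht]
        nlinarith
    have h1 := hge _ (hpos _ hR _ hP)
    rw [apply_form_add, apply_form_add, apply_form_smul, apply_form_smul] at h1
    have h2 : 0 < t * Λ (sqForm b) := by linarith
    have h3 : 0 ≤ Λ (sqForm b) := hΛ _ ⟨sqForm_symm, fun x => by
      rw [sqForm_apply_self hb]; positivity⟩
    rcases h3.eq_or_lt with h4 | h4
    · rw [← h4, mul_zero] at h2; exact absurd h2 (lt_irrefl _)
    · exact h4
  -- Radii below `r - φ.rOut` keep every translate used by the mollifier inside the ball of radius
  -- `r`.
  refine absurd hlt (not_lt.2 (le_apply_hessian_of_mem_dirichletDominated hb hΛ hI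
    (sub_pos.2 hφ) hw fun ρ hρ hρr => ?_))
  refine convolution_mem_of_forall_mem μ φ hv hw.continuous (fun _ => rfl)
    (convex_dirichletDominated x₀ ρ s) (isClosed_dirichletDominated x₀ ρ s) fun y hy => ?_
  refine HessianSubsolution.mem_dirichletDominated hb hΛ hI hρ (v := fun x => v (x - y))
    (by fun_prop) (HessianSubsolution.comp_sub_right
      (hsub.mono (fun B hB => (hge B hB).le) subset_rfl) y fun x hx => ?_)
  rw [mem_ball_iff_norm] at hx ⊢
  rw [mem_ball_zero_iff] at hy
  have : x - y - x₀ = (x - x₀) - y := by abel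
  rw [this]
  linarith [norm_sub_le (x - x₀) y]

end Mollification

/-! ### The cone and monotonicity of `f` -/

section Cone

variable {n : ℕ} {Γ : Set (Fin n → ℝ)}

lemma IsAdmissibleCone.mem_of_pos (hΓ : IsAdmissibleCone Γ) {x : Fin n → ℝ} (hx : ∀ i, 0 < x i) :
    x ∈ Γ := by
  refine hΓ.sigmaCone_subset fun i _ hi => ?_
  refine Finset.sum_pos (fun s _ => Finset.prod_pos fun j _ => hx j) ?_
  exact Finset.powersetCard_nonempty.2 (by simpa using hi)

lemma IsAdmissibleCone.add_mem (hΓ : IsAdmissibleCone Γ) {x y : Fin n → ℝ} (hx : x ∈ Γ)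
    (hy : y ∈ Γ) : x + y ∈ Γ := by
  have := hΓ.cone _ (hΓ.convex hx hy (by norm_num : (0 : ℝ) ≤ 1 / 2)
    (by norm_num : (0 : ℝ) ≤ 1 / 2) (by norm_num)) 2 (by norm_num)
  convert this using 1
  ext i; simp; ring

lemma IsAdmissibleCone.closure_add_mem (hΓ : IsAdmissibleCone Γ) {x y : Fin n → ℝ}
    (hx : x ∈ closure Γ) (hy : y ∈ Γ) : x + y ∈ Γ := by
  have hopen : IsOpen ((fun z => y + (x - z)) ⁻¹' Γ) :=
    hΓ.isOpen.preimage (by fun_prop)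
  obtain ⟨z, hz, hzΓ⟩ := mem_closure_iff.1 hx _ hopen (by simpa using hy)
  have := hΓ.add_mem hzΓ hz
  convert this using 1
  dsimp only
  abel

lemma IsAdmissibleCone.closure_add_nonneg (hΓ : IsAdmissibleCone Γ) {x y : Fin n → ℝ}
    (hx : x ∈ closure Γ) (hy : ∀ i, 0 ≤ y i) : x + y ∈ closure Γ := by
  have ht : Tendsto (fun ε : ℝ => x + (y + fun _ => ε)) (𝓝[>] 0) (𝓝 (x + y)) := by
    have : Continuous fun ε : ℝ => x + (y + fun _ => ε) := by fun_prop
    have h := this.tendsto 0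
    have e : x + (y + fun _ => (0 : ℝ)) = x + y := by ext; simp
    rw [e] at h
    exact h.mono_left nhdsWithin_le_nhds
  refine mem_closure_of_tendsto ht ?_
  filter_upwards [self_mem_nhdsWithin] with ε hε
  exact hΓ.closure_add_mem hx (hΓ.mem_of_pos fun i => add_pos_of_nonneg_of_pos (hy i) hε)

lemma IsAdmissibleCone.smul_mem_closure (hΓ : IsAdmissibleCone Γ) {x : Fin n → ℝ}
    (hx : x ∈ closure Γ) {t : ℝ} (ht : 0 < t) : t • x ∈ closure Γ :=
  map_mem_closure (continuous_const_smul t) hx fun y hy => hΓ.cone y hy t ht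

lemma IsAdmissibleCone.comp_mem_closure (hΓ : IsAdmissibleCone Γ) {x : Fin n → ℝ}
    (hx : x ∈ closure Γ) (σ : Equiv.Perm (Fin n)) : x ∘ σ ∈ closure Γ :=
  map_mem_closure (f := fun y : Fin n → ℝ => y ∘ σ)
    (continuous_pi fun i => continuous_apply (σ i)) hx fun y hy => hΓ.symmetric y hy σ

variable {f : (Fin n → ℝ) → ℝ}

lemma IsAdmissibleFunction.nonneg (hf : IsAdmissibleFunction Γ f) (hΓ : IsAdmissibleCone Γ)
    {x : Fin n → ℝ} (hx : x ∈ closure Γ) : 0 ≤ f x := by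
  by_cases h : x ∈ Γ
  · exact (hf.pos x h).le
  · exact (hf.zero_on_frontier x ⟨hx, by rwa [hΓ.isOpen.interior_eq]⟩).ge

/-- A concave function bounded below on a ray cannot decrease along it. This gives monotonicity up
to `∂Γ`, both in nonnegative directions and radially. -/
lemma IsAdmissibleFunction.le_of_ray (hf : IsAdmissibleFunction Γ f) (hΓ : IsAdmissibleCone Γ)
    {x y : Fin n → ℝ} (h : ∀ t : ℝ, 0 ≤ t → x + t • y ∈ closure Γ) : f x ≤ f (x + y) := by
  have hx : x ∈ closure Γ := by simpa using h 0 le_rfl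
  by_contra! hlt
  have hfx : 0 < f x := (hf.nonneg hΓ (by simpa using h 1 zero_le_one)).trans_lt hlt
  -- Concavity between `x` and `x + y/a` gives `f(x + y) ≥ (1 - a) f(x)`; here `a f(x)` is half of
  -- the supposed drop.
  set a : ℝ := (f x - f (x + y)) / (2 * f x) with ha
  have hxy : 0 ≤ f (x + y) := hf.nonneg hΓ (by simpa using h 1 zero_le_one)
  have ha0 : 0 < a := div_pos (by linarith) (by linarith)
  have ha1 : a ≤ 1 := by rw [ha, div_le_one (by linarith)]; linarith
  have h2 := hf.concaveOn.2 hx (h (1 / a) (by positivity)) (sub_nonneg.2 ha1) ha0.le (by ring)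
  have e : (1 - a) • x + a • (x + (1 / a) • y) = x + y := by
    rw [smul_add, smul_smul, mul_one_div_cancel ha0.ne', one_smul, ← add_assoc, ← add_smul]
    simp
  rw [e, smul_eq_mul, smul_eq_mul] at h2
  have h3 := mul_nonneg ha0.le (hf.nonneg hΓ (h (1 / a) (by positivity)))
  have h4 : a * f x = (f x - f (x + y)) / 2 := by
    rw [ha, div_mul_eq_mul_div, mul_comm 2, ← div_div, mul_div_cancel_right₀ _ hfx.ne']
  linarith

lemma IsAdmissibleFunction.le_add_nonneg (hf : IsAdmissibleFunction Γ f) (hΓ : IsAdmissibleCone Γ)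
    {x y : Fin n → ℝ} (hx : x ∈ closure Γ) (hy : ∀ i, 0 ≤ y i) : f x ≤ f (x + y) :=
  hf.le_of_ray hΓ fun _ ht => hΓ.closure_add_nonneg hx fun i => mul_nonneg ht (hy i)

/-- Adding a multiple of `(1, …, 1)` increases `f` by a uniform amount below a level which `f`
exceeds on the diagonal. -/
lemma IsAdmissibleFunction.exists_shift (hf : IsAdmissibleFunction Γ f) (hΓ : IsAdmissibleCone Γ)
    {R S δ : ℝ} (hR : 0 < R) (hS : S < f fun _ => R) (hδ : 0 < δ) :
    ∃ τ > 0, ∀ c ≤ S, ∀ x ∈ closure Γ, c - τ ≤ f x → c ≤ f (x + fun _ => δ) := by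
  -- This `t` solves `(1 - t)(x + δ) = (1 - t)x + tR`. Then `f(x + δ) ≥ f((1 - t)(x + δ)) ≥ (1 - t)
  -- f(x) + t f(R,…,R)`.
  set t : ℝ := δ / (R + δ) with ht
  have ht0 : 0 < t := by positivity
  have ht1 : t < 1 := by rw [ht, div_lt_one (by positivity)]; linarith
  refine ⟨t * ((f fun _ => R) - S), mul_pos ht0 (by linarith), fun c hc x hx hcx => ?_⟩
  set y : Fin n → ℝ := x + fun _ => δ with hy
  have hyΓ : y ∈ closure Γ := hΓ.closure_add_nonneg hx fun _ => hδ.le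
  have h1 : f ((1 - t) • y) ≤ f ((1 - t) • y + t • y) := by
    refine hf.le_of_ray hΓ fun s hs => ?_
    rw [smul_smul, ← add_smul]
    exact hΓ.smul_mem_closure hyΓ (by nlinarith)
  rw [← add_smul, sub_add_cancel, one_smul] at h1
  have h2 := hf.concaveOn.2 hx (subset_closure (hΓ.mem_of_pos (x := fun _ => R) fun _ => hR))
    (sub_nonneg.2 ht1.le) ht0.le (by ring)
  have e : (1 - t) • x + t • (fun _ : Fin n => R) = (1 - t) • y := by
    ext i
    simp only [hy, Pi.add_apply, Pi.smul_apply, smul_eq_mul, mul_add]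
    congr 1
    rw [ht]; field_simp; ring
  rw [e, smul_eq_mul, smul_eq_mul] at h2
  have h3 : (1 - t) * (c - t * ((f fun _ => R) - S)) ≤ (1 - t) * f x :=
    mul_le_mul_of_nonneg_left hcx (by linarith)
  have h4 : 0 ≤ t * (t * ((f fun _ => R) - S)) :=
    mul_nonneg ht0.le (mul_nonneg ht0.le (by linarith))
  have h5 : t * c ≤ t * S := mul_le_mul_of_nonneg_left hc ht0.le
  linarith

end Cone

/-! ### Convex conditions on eigenvalues of Hermitian matrices -/

section Matrices

open scoped ComplexOrder

variable {n : ℕ}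

/-- The Hermitian matrices all of whose unitary conjugates have diagonal in `C`. -/
def diagonalSet (C : Set (Fin n → ℝ)) : Set (Matrix (Fin n) (Fin n) ℂ) :=
  {H | H.IsHermitian ∧
    ∀ U ∈ Matrix.unitaryGroup (Fin n) ℂ, (fun i => ((U * H * star U) i i).re) ∈ C}

lemma diagonalSet_mono {C C' : Set (Fin n → ℝ)} (h : C ⊆ C') : diagonalSet C ⊆ diagonalSet C' :=
  fun _ hH => ⟨hH.1, fun U hU => h (hH.2 U hU)⟩

/-- The easy half of the Schur–Horn theorem, in terms of a symmetric convex set. -/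
lemma eigenvalues_mem_iff {C : Set (Fin n → ℝ)} (hC : Convex ℝ C)
    (hsymm : ∀ x ∈ C, ∀ σ : Equiv.Perm (Fin n), x ∘ σ ∈ C) {H : Matrix (Fin n) (Fin n) ℂ}
    (hH : H.IsHermitian) : hH.eigenvalues ∈ C ↔ H ∈ diagonalSet C := by
  constructor
  · refine fun hlam => ⟨hH, fun U hU => ?_⟩
    set V : Matrix (Fin n) (Fin n) ℂ := hH.eigenvectorUnitary.1 with hV
    set W := U * V with hW
    have hWu : W ∈ Matrix.unitaryGroup (Fin n) ℂ := mul_mem hU hH.eigenvectorUnitary.2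
    -- The diagonal of `U H U*` is `M λ` with `M = (|W i j|²)` doubly stochastic; by Birkhoff's
    -- theorem it is a convex combination of permutations of `λ`.
    set M : Matrix (Fin n) (Fin n) ℝ := Matrix.of fun i j => Complex.normSq (W i j) with hM
    have hMds : M ∈ doublyStochastic ℝ (Fin n) := by
      rw [mem_doublyStochastic_iff_sum]
      refine ⟨fun i j => Complex.normSq_nonneg _, fun i => ?_, fun j => ?_⟩
      · have := congrFun (congrFun (Matrix.mem_unitaryGroup_iff.1 hWu) i) i
        rw [Matrix.mul_apply, Matrix.one_apply_eq] at this
        have h2 := congrArg Complex.re this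
        simpa [hM, Matrix.star_apply, Complex.mul_conj] using h2
      · have := congrFun (congrFun (Matrix.mem_unitaryGroup_iff'.1 hWu) j) j
        rw [Matrix.mul_apply, Matrix.one_apply_eq] at this
        have h2 := congrArg Complex.re this
        simpa [hM, Matrix.star_apply, Complex.mul_conj, mul_comm] using h2
    have hdiag : (fun i => ((U * H * star U) i i).re) = M.mulVec hH.eigenvalues := by
      have h1 : U * H * star U =
          W * Matrix.diagonal (RCLike.ofReal ∘ hH.eigenvalues) * star W := by
        conv_lhs => rw [hH.spectral_theorem]
        simp only [Unitary.conjStarAlgAut_apply, hW, star_mul, Matrix.mul_assoc]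
        rfl
      ext i
      rw [h1, Matrix.mul_apply, Complex.re_sum, Matrix.mulVec, dotProduct]
      refine Finset.sum_congr rfl fun j _ => ?_
      rw [Matrix.mul_diagonal, Matrix.star_apply]
      simp [hM, Complex.normSq_apply]
      ring
    rw [hdiag]
    rw [← SetLike.mem_coe, doublyStochastic_eq_convexHull_permMatrix] at hMds
    have hconv : Convex ℝ {N : Matrix (Fin n) (Fin n) ℝ | N.mulVec hH.eigenvalues ∈ C} := by
      intro N hN N' hN' α β hα hβ hαβ
      rw [mem_ofPred_eq, Matrix.add_mulVec, Matrix.smul_mulVec, Matrix.smul_mulVec]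
      exact hC hN hN' hα hβ hαβ
    refine convexHull_min ?_ hconv hMds
    rintro _ ⟨σ, rfl⟩
    rw [mem_ofPred_eq, Matrix.permMatrix_mulVec]
    exact hsymm _ hlam σ
  · rintro ⟨-, h⟩
    have := h (star (hH.eigenvectorUnitary : Matrix (Fin n) (Fin n) ℂ))
      (star hH.eigenvectorUnitary).2
    rw [star_star] at this
    convert this using 1
    have h1 := hH.conjStarAlgAut_star_eigenvectorUnitary
    rw [Unitary.conjStarAlgAut_apply] at h1
    simp only [Unitary.coe_star, star_star] at h1
    ext i
    rw [h1]
    simp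

/-- For fixed `U` the diagonal of `U H U*` is real-linear in `H`, which is the reason for encoding
eigenvalue conditions by diagonals. -/
lemma convex_diagonalSet {C : Set (Fin n → ℝ)} (hC : Convex ℝ C) : Convex ℝ (diagonalSet C) := by
  intro H hH K hK α β hα hβ hαβ
  refine ⟨?_, fun U hU => ?_⟩
  · have h1 := hH.1
    have h2 := hK.1
    simp only [Matrix.IsHermitian, Matrix.conjTranspose_add, Matrix.conjTranspose_smul,
      star_trivial, h1.eq, h2.eq]
  · convert hC (hH.2 U hU) (hK.2 U hU) hα hβ hαβ using 1
    ext i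
    simp [Matrix.mul_add, Matrix.add_mul]

lemma isClosed_diagonalSet {C : Set (Fin n → ℝ)} (hC : IsClosed C) :
    IsClosed (diagonalSet C) := by
  have e : diagonalSet C = {H : Matrix (Fin n) (Fin n) ℂ | H.conjTranspose = H} ∩
      ⋂ U ∈ Matrix.unitaryGroup (Fin n) ℂ,
        (fun (H : Matrix (Fin n) (Fin n) ℂ) i => ((U * H * star U) i i).re) ⁻¹' C := by
    ext H; simp [diagonalSet, Matrix.IsHermitian]
  rw [e]
  refine (isClosed_eq (by fun_prop) continuous_id).inter
    (isClosed_biInter fun U _ => hC.preimage (continuous_pi fun i => ?_))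
  exact Complex.continuous_re.comp
    (((continuous_const.matrix_mul continuous_id).matrix_mul continuous_const).matrix_elem i i)

lemma diag_add_real_smul_one (U : Matrix (Fin n) (Fin n) ℂ)
    (hU : U ∈ Matrix.unitaryGroup (Fin n) ℂ) (H : Matrix (Fin n) (Fin n) ℂ) (δ : ℝ) :
    (fun i => ((U * (H + δ • 1) * star U) i i).re) =
      (fun i => ((U * H * star U) i i).re) + fun _ => δ := by
  ext i
  have h : U * star U = 1 := Matrix.mem_unitaryGroup_iff.1 hU
  have : U * (H + δ • 1) * star U = U * H * star U + δ • 1 := by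
    rw [Matrix.mul_add, Matrix.add_mul, Matrix.mul_smul, Matrix.smul_mul, Matrix.mul_one, h]
  simp [this]

lemma isHermitian_add_real_smul_one {H : Matrix (Fin n) (Fin n) ℂ} (hH : H.IsHermitian) (δ : ℝ) :
    (H + δ • 1).IsHermitian := by
  simp only [Matrix.IsHermitian, Matrix.conjTranspose_add, Matrix.conjTranspose_smul,
      star_trivial, hH.eq, Matrix.conjTranspose_one]

lemma add_smul_one_mem_diagonalSet {C C' : Set (Fin n → ℝ)} {H : Matrix (Fin n) (Fin n) ℂ}
    (hH : H ∈ diagonalSet C) {δ : ℝ} (h : ∀ x ∈ C, x + (fun _ => δ) ∈ C') :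
    H + δ • 1 ∈ diagonalSet C' := by
  refine ⟨isHermitian_add_real_smul_one hH.1 δ, fun U hU => ?_⟩
  rw [diag_add_real_smul_one U hU]
  exact h _ (hH.2 U hU)

lemma smul_one_mem_diagonalSet {C : Set (Fin n → ℝ)} {R : ℝ} (h : (fun _ => R) ∈ C) :
    R • (1 : Matrix (Fin n) (Fin n) ℂ) ∈ diagonalSet C := by
  have : (0 : Matrix (Fin n) (Fin n) ℂ) ∈ diagonalSet {0} :=
    ⟨Matrix.isHermitian_zero, fun U _ => by simp; rfl⟩
  have := add_smul_one_mem_diagonalSet this (δ := R) (C' := C) (by rintro x rfl; simpa using h)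
  simpa using this

lemma add_posSemidef_mem_diagonalSet {C : Set (Fin n → ℝ)}
    (hC : ∀ x ∈ C, ∀ y : Fin n → ℝ, (∀ i, 0 ≤ y i) → x + y ∈ C) {H P : Matrix (Fin n) (Fin n) ℂ}
    (hH : H ∈ diagonalSet C) (hP : P.PosSemidef) : H + P ∈ diagonalSet C := by
  refine ⟨hH.1.add hP.1, fun U hU => ?_⟩
  convert hC _ (hH.2 U hU) (fun i => ((U * P * star U) i i).re) fun i => ?_ using 1
  · ext i; simp [Matrix.mul_add, Matrix.add_mul]
  · have h1 : (U * P * U.conjTranspose).PosSemidef := hP.mul_mul_conjTranspose_same U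
    exact (Complex.le_def.1 (h1.diag_nonneg (i := i))).1

variable {Γ : Set (Fin n → ℝ)} {f : (Fin n → ℝ) → ℝ}

lemma coneMatrices_eq (hΓ : IsAdmissibleCone Γ) : coneMatrices Γ = diagonalSet Γ := by
  ext H
  constructor
  · rintro ⟨hH, h⟩
    exact (eigenvalues_mem_iff hΓ.convex hΓ.symmetric hH).1 h
  · exact fun h => ⟨h.1, (eigenvalues_mem_iff hΓ.convex hΓ.symmetric h.1).2 h⟩

lemma closure_coneMatrices (hΓ : IsAdmissibleCone Γ) :
    closure (coneMatrices Γ) = diagonalSet (closure Γ) := by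
  rw [coneMatrices_eq hΓ]
  refine Subset.antisymm (closure_minimal (diagonalSet_mono subset_closure)
    (isClosed_diagonalSet isClosed_closure)) fun H hH => ?_
  have ht : Tendsto (fun ε : ℝ => H + ε • (1 : Matrix (Fin n) (Fin n) ℂ)) (𝓝[>] 0) (𝓝 H) := by
    have : Continuous fun ε : ℝ => H + ε • (1 : Matrix (Fin n) (Fin n) ℂ) := by fun_prop
    have h := this.tendsto 0
    rw [zero_smul, add_zero] at h
    exact h.mono_left nhdsWithin_le_nhds
  refine mem_closure_of_tendsto ht ?_
  filter_upwards [self_mem_nhdsWithin] with ε hε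
  exact add_smul_one_mem_diagonalSet hH fun x hx =>
    hΓ.closure_add_mem hx (hΓ.mem_of_pos fun _ => hε)

/-- The superlevel sets of `f` on `closure Γ`. -/
def superlevel (Γ : Set (Fin n → ℝ)) (f : (Fin n → ℝ) → ℝ) (c : ℝ) : Set (Fin n → ℝ) :=
  {x | x ∈ closure Γ ∧ c ≤ f x}

lemma convex_superlevel (hf : IsAdmissibleFunction Γ f) (c : ℝ) : Convex ℝ (superlevel Γ f c) :=
  hf.concaveOn.convex_ge c

lemma isClosed_superlevel (hf : IsAdmissibleFunction Γ f) (c : ℝ) :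
    IsClosed (superlevel Γ f c) :=
  hf.continuousOn.preimage_isClosed_of_isClosed isClosed_closure isClosed_Ici

lemma add_nonneg_mem_superlevel (hΓ : IsAdmissibleCone Γ) (hf : IsAdmissibleFunction Γ f) {c : ℝ}
    {x : Fin n → ℝ} (hx : x ∈ superlevel Γ f c) {y : Fin n → ℝ} (hy : ∀ i, 0 ≤ y i) :
    x + y ∈ superlevel Γ f c :=
  ⟨hΓ.closure_add_nonneg hx.1 hy, hx.2.trans (hf.le_add_nonneg hΓ hx.1 hy)⟩

/-- The value `⊥` outside the closure of the cone matches the condition `x ∈ closure Γ` built into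
`superlevel`. -/
lemma le_hessianOperator_iff (hΓ : IsAdmissibleCone Γ) (hf : IsAdmissibleFunction Γ f) {c : ℝ}
    {H : Matrix (Fin n) (Fin n) ℂ} :
    (c : EReal) ≤ hessianOperator Γ f H ↔ H ∈ diagonalSet (superlevel Γ f c) := by
  have hsymm : ∀ x ∈ superlevel Γ f c, ∀ σ : Equiv.Perm (Fin n), x ∘ σ ∈ superlevel Γ f c :=
    fun x hx σ => ⟨hΓ.comp_mem_closure hx.1 σ, by rw [hf.symmetric x hx.1 σ]; exact hx.2⟩
  have hsymm' : ∀ x ∈ closure Γ, ∀ σ : Equiv.Perm (Fin n), x ∘ σ ∈ closure Γ :=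
    fun x hx σ => hΓ.comp_mem_closure hx σ
  rw [hessianOperator]
  split_ifs with h
  · rw [← eigenvalues_mem_iff (convex_superlevel hf c) hsymm h.1, EReal.coe_le_coe_iff]
    rw [closure_coneMatrices hΓ, ← eigenvalues_mem_iff hΓ.convex.closure hsymm' h.1] at h
    exact ⟨fun h2 => ⟨h.2, h2⟩, fun h2 => h2.2⟩
  · simp only [le_bot_iff, EReal.coe_ne_bot, false_iff]
    refine fun h2 => h ⟨h2.1, ?_⟩
    rw [closure_coneMatrices hΓ]
    exact diagonalSet_mono (fun x hx => hx.1) h2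

end Matrices

/-! ### Sup-convolutions -/

section SupConvolution

variable {E : Type*} [NormedAddCommGroup E]

/-- Sup-convolutions over a compact set are attained and continuous. -/
lemma exists_supConvolution {K : Set E} (hK : IsCompact K) (hne : K.Nonempty) {g : E → ℝ}
    (hg : UpperSemicontinuousOn g K) {ε : ℝ} (hε : 0 < ε) :
    ∃ v : E → ℝ, Continuous v ∧ (∀ z, ∃ w ∈ K, v z = g w - ‖z - w‖ ^ 2 / ε) ∧
      ∀ z, ∀ w ∈ K, g w - ‖z - w‖ ^ 2 / ε ≤ v z := by
  have hmax : ∀ z, ∃ w ∈ K, IsMaxOn (fun w => g w + -(‖z - w‖ ^ 2 / ε)) K w := fun z =>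
    UpperSemicontinuousOn.exists_isMaxOn hne hK
      (hg.add (Continuous.upperSemicontinuous
        (by fun_prop : Continuous fun w => -(‖z - w‖ ^ 2 / ε)) |>.upperSemicontinuousOn K))
  choose W hWK hW using hmax
  obtain ⟨R, hR⟩ := hK.isBounded.exists_norm_le
  have hle : ∀ z, ∀ w ∈ K, g w - ‖z - w‖ ^ 2 / ε ≤ g (W z) - ‖z - W z‖ ^ 2 / ε := fun z w hw => by
    have := hW z hw
    simpa [sub_eq_add_neg] using this
  refine ⟨fun z => g (W z) - ‖z - W z‖ ^ 2 / ε, ?_, fun z => ⟨W z, hWK z, rfl⟩, hle⟩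
  -- A bound uniform in `w ∈ K`: comparing the maximisers at two points then makes the
  -- sup-convolution locally Lipschitz.
  have hsq : ∀ z z' w : E, w ∈ K →
      ‖z - w‖ ^ 2 - ‖z' - w‖ ^ 2 ≤ ‖z - z'‖ * (‖z‖ + ‖z'‖ + 2 * R) := by
    intro z z' w hw
    have h1 : ‖z - w‖ ≤ ‖z - z'‖ + ‖z' - w‖ := by
      have : z - w = (z - z') + (z' - w) := by abel
      rw [this]; exact norm_add_le _ _
    have h2 : ‖z - w‖ ≤ ‖z‖ + R := (norm_sub_le _ _).trans (by linarith [hR w hw])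
    have h3 : ‖z' - w‖ ≤ ‖z'‖ + R := (norm_sub_le _ _).trans (by linarith [hR w hw])
    have h4 := norm_nonneg (z - w)
    have h5 := norm_nonneg (z' - w)
    have h6 := norm_nonneg (z - z')
    calc ‖z - w‖ ^ 2 - ‖z' - w‖ ^ 2 = (‖z - w‖ - ‖z' - w‖) * (‖z - w‖ + ‖z' - w‖) := by ring
      _ ≤ ‖z - z'‖ * (‖z - w‖ + ‖z' - w‖) :=
        mul_le_mul_of_nonneg_right (by linarith) (by linarith)
      _ ≤ _ := mul_le_mul_of_nonneg_left (by linarith) h6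
  rw [continuous_iff_continuousAt]
  intro z
  rw [ContinuousAt, tendsto_iff_dist_tendsto_zero]
  refine squeeze_zero (fun _ => dist_nonneg)
    (g := fun y => ‖y - z‖ * (‖y‖ + ‖z‖ + 2 * R) / ε) (fun y => ?_) ?_
  · rw [Real.dist_eq, abs_le]
    have h1 := hle y (W z) (hWK z)
    have h2 := hle z (W y) (hWK y)
    have h3 := div_le_div_of_nonneg_right (hsq y z (W z) (hWK z)) hε.le
    have h4 := div_le_div_of_nonneg_right (hsq z y (W y) (hWK y)) hε.le
    rw [sub_div] at h3 h4
    rw [norm_sub_rev z y, add_comm ‖z‖] at h4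
    constructor <;> linarith
  · have : Continuous fun y : E => ‖y - z‖ * (‖y‖ + ‖z‖ + 2 * R) / ε := by fun_prop
    simpa using this.tendsto z

variable [NormedSpace ℝ E]

/-- If `q` touches `v` at `z` and the supremum is attained at `w`, then `q` translated by `z - w`,
plus a constant, touches `g` at `w` with the same Hessian. -/
lemma HessianSubsolution.supConvolution {K : Set E} {g v : E → ℝ} {ε : ℝ}
    (hatt : ∀ z, ∃ w ∈ K, v z = g w - ‖z - w‖ ^ 2 / ε)
    (hle : ∀ z, ∀ w ∈ K, g w - ‖z - w‖ ^ 2 / ε ≤ v z)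
    {𝒦 : Set (E →L[ℝ] E →L[ℝ] ℝ)} {O O' : Set E} (hsub : HessianSubsolution 𝒦 O g)
    (hO : ∀ z ∈ O', ∀ w ∈ K, v z = g w - ‖z - w‖ ^ 2 / ε → w ∈ O ∧ K ∈ 𝓝 w) :
    HessianSubsolution 𝒦 O' v := by
  intro z hz q h1 h2 h3
  obtain ⟨w, hwK, hw⟩ := hatt z
  obtain ⟨hwO, hKw⟩ := hO z hz w hwK hw
  have e : w + (z - w) = z := by abel
  have key := hsub w hwO (fun y => q (y + (z - w)) + ‖z - w‖ ^ 2 / ε) ?_ ?_ ?_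
  · rwa [hessian_add_const (fun y => q (y + (z - w))), hessian_comp_add_right, e] at key
  · have : ContDiffAt ℝ 2 q (w + (z - w)) := by rwa [e]
    exact (ContDiffAt.comp (f := fun y => y + (z - w)) w this
      (contDiffAt_id.add contDiffAt_const)).add contDiffAt_const
  · simp only [e]; linarith
  · have ht : Tendsto (fun y => y + (z - w)) (𝓝 w) (𝓝 z) := by
      have := (continuous_add_const (z - w)).tendsto w
      rwa [e] at this
    filter_upwards [ht.eventually h3, hKw] with y hy hyK
    have h4 := hle (y + (z - w)) y hyK
    have e2 : y + (z - w) - y = z - w := by abel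
    rw [e2] at h4
    linarith

end SupConvolution

/-! ### From real bilinear forms to complex Hessians -/

section ComplexHessian

variable {n : ℕ}

/-- The sesquilinear part of a real bilinear form on `ℂⁿ`, as a matrix. -/
noncomputable def complexForm
    (B : EuclideanSpace ℂ (Fin n) →L[ℝ] EuclideanSpace ℂ (Fin n) →L[ℝ] ℝ) :
    Matrix (Fin n) (Fin n) ℂ :=
  Matrix.of fun j k =>
    (1 / 4 : ℂ) * (((B (EuclideanSpace.single j 1) (EuclideanSpace.single k 1)
        + B (EuclideanSpace.single j Complex.I) (EuclideanSpace.single k Complex.I) : ℝ) : ℂ)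
      + Complex.I * ((B (EuclideanSpace.single j 1) (EuclideanSpace.single k Complex.I)
        - B (EuclideanSpace.single j Complex.I) (EuclideanSpace.single k 1) : ℝ) : ℂ))

lemma complexHessian_eq (q : EuclideanSpace ℂ (Fin n) → ℝ) (z : EuclideanSpace ℂ (Fin n)) :
    complexHessian q z = complexForm (hessian q z) := rfl

variable (B B' : EuclideanSpace ℂ (Fin n) →L[ℝ] EuclideanSpace ℂ (Fin n) →L[ℝ] ℝ)

lemma complexForm_add : complexForm (B + B') = complexForm B + complexForm B' := by
  ext j k; simp [complexForm]; ring

lemma complexForm_smul (c : ℝ) : complexForm (c • B) = c • complexForm B := by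
  ext j k; simp [complexForm]; ring

lemma continuous_complexForm : Continuous (complexForm (n := n)) := by
  refine continuous_matrix fun j k => ?_
  simp only [complexForm, Matrix.of_apply]
  fun_prop

lemma isHermitian_complexForm (h : ∀ v w, B v w = B w v) : (complexForm B).IsHermitian := by
  ext j k
  simp only [complexForm, Matrix.conjTranspose_apply, Matrix.of_apply]
  rw [h (EuclideanSpace.single k 1), h (EuclideanSpace.single k Complex.I),
    h (EuclideanSpace.single k 1), h (EuclideanSpace.single k Complex.I)]
  apply Complex.ext <;> simp

open scoped ComplexOrder in
lemma posSemidef_complexForm (h : PosSemidefForm B) : (complexForm B).PosSemidef := by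
  have hH := isHermitian_complexForm B h.1
  refine Matrix.PosSemidef.of_dotProduct_mulVec_nonneg hH fun x => ?_
  have hreal : (star x ⬝ᵥ (complexForm B).mulVec x).im = 0 :=
    hH.im_star_dotProduct_mulVec_self x
  rw [Complex.le_def]
  refine ⟨?_, by simpa using hreal.symm⟩
  -- The `a j` sum to the conjugate of `x` and the `a' j` to `i` times it; the Hermitian form at `x`
  -- is a quarter of the sum of the values of `B` on these two vectors.
  let a : Fin n → EuclideanSpace ℂ (Fin n) := fun j =>
    (x j).re • EuclideanSpace.single j (1 : ℂ) - (x j).im • EuclideanSpace.single j Complex.I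
  let a' : Fin n → EuclideanSpace ℂ (Fin n) := fun j =>
    (x j).im • EuclideanSpace.single j (1 : ℂ) + (x j).re • EuclideanSpace.single j Complex.I
  have hsum : ∀ u : Fin n → EuclideanSpace ℂ (Fin n),
      B (∑ j, u j) (∑ j, u j) = ∑ j, ∑ k, B (u j) (u k) := fun u => by
    rw [map_sum B, sum_apply]
    exact Finset.sum_congr rfl fun j _ => map_sum _ _ _
  have e : (star x ⬝ᵥ (complexForm B).mulVec x).re =
      (1 / 4) * (B (∑ j, a j) (∑ j, a j) + B (∑ j, a' j) (∑ j, a' j)) := by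
    simp only [hsum, dotProduct, Matrix.mulVec, Complex.re_sum, Finset.mul_sum,
      ← Finset.sum_add_distrib]
    refine Finset.sum_congr rfl fun j _ => Finset.sum_congr rfl fun k _ => ?_
    simp [complexForm, a, a']
    ring
  rw [e]
  have := h.2 (∑ j, a j)
  have := h.2 (∑ j, a' j)
  simp only [Complex.zero_re]
  linarith

/-- The standard real basis of `ℂⁿ`. -/
noncomputable def realBasis (n : ℕ) : Module.Basis (Fin 2 × Fin n) ℝ (EuclideanSpace ℂ (Fin n)) :=
  Complex.basisOneI.smulTower (EuclideanSpace.basisFun (Fin n) ℂ).toBasis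

lemma realBasis_repr_zero (x : EuclideanSpace ℂ (Fin n)) (j : Fin n) :
    (realBasis n).repr x (0, j) = (x j).re := by
  simp [realBasis, Module.Basis.smulTower_repr]

lemma realBasis_repr_one (x : EuclideanSpace ℂ (Fin n)) (j : Fin n) :
    (realBasis n).repr x (1, j) = (x j).im := by
  simp [realBasis, Module.Basis.smulTower_repr]

lemma norm_sq_eq_sum_realBasis (x : EuclideanSpace ℂ (Fin n)) :
    ‖x‖ ^ 2 = ∑ i, (realBasis n).repr x i ^ 2 := by
  rw [Fintype.sum_prod_type, Fin.sum_univ_two, EuclideanSpace.norm_sq_eq, ← Finset.sum_add_distrib]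
  refine Finset.sum_congr rfl fun j _ => ?_
  rw [realBasis_repr_zero, realBasis_repr_one, Complex.sq_norm, Complex.normSq_apply]
  ring

lemma sqForm_realBasis (v w : EuclideanSpace ℂ (Fin n)) :
    sqForm (realBasis n) v w = 2 * ∑ j, ((v j).re * (w j).re + (v j).im * (w j).im) := by
  simp only [sqForm, coordCLM, Fintype.sum_prod_type, Fin.sum_univ_two, Finset.sum_add_distrib,
    mul_add, Finset.mul_sum]
  simp [realBasis_repr_zero, realBasis_repr_one]

lemma complexForm_sqForm : complexForm (sqForm (realBasis n)) = 1 := by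
  ext j k
  simp only [complexForm, Matrix.of_apply, sqForm_realBasis]
  rcases eq_or_ne j k with rfl | h
  · simp [apply_ite]
    norm_num
  · simp [apply_ite, h, h.symm]

variable {Γ : Set (Fin n → ℝ)} {f : (Fin n → ℝ) → ℝ}

/-- The bilinear forms `B` with `F(B) ≥ c`. -/
def formSuperlevel (Γ : Set (Fin n → ℝ)) (f : (Fin n → ℝ) → ℝ) (c : ℝ) :
    Set (EuclideanSpace ℂ (Fin n) →L[ℝ] EuclideanSpace ℂ (Fin n) →L[ℝ] ℝ) :=
  {B | complexForm B ∈ diagonalSet (superlevel Γ f c)}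

lemma formSuperlevel_anti {c c' : ℝ} (h : c ≤ c') :
    formSuperlevel Γ f c' ⊆ formSuperlevel Γ f c :=
  fun _ hB => diagonalSet_mono (C' := superlevel Γ f c)
    (fun _ hx => ⟨hx.1, h.trans hx.2⟩) hB

lemma convex_formSuperlevel (hf : IsAdmissibleFunction Γ f) (c : ℝ) :
    Convex ℝ (formSuperlevel Γ f c) := by
  intro B hB B' hB' α β hα hβ hαβ
  rw [formSuperlevel, mem_ofPred_eq, complexForm_add, complexForm_smul, complexForm_smul]
  exact convex_diagonalSet (convex_superlevel hf c) hB hB' hα hβ hαβ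

lemma isClosed_formSuperlevel (hf : IsAdmissibleFunction Γ f) (c : ℝ) :
    IsClosed (formSuperlevel Γ f c) :=
  (isClosed_diagonalSet (isClosed_superlevel hf c)).preimage continuous_complexForm

lemma add_mem_formSuperlevel (hΓ : IsAdmissibleCone Γ) (hf : IsAdmissibleFunction Γ f) {c : ℝ} :
    ∀ B ∈ formSuperlevel Γ f c, ∀ P, PosSemidefForm P → B + P ∈ formSuperlevel Γ f c := by
  intro B hB P hP
  rw [formSuperlevel, mem_ofPred_eq, complexForm_add]
  exact add_posSemidef_mem_diagonalSet
    (fun x hx y hy => add_nonneg_mem_superlevel hΓ hf hx hy) hB (posSemidef_complexForm P hP)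

lemma smul_sqForm_mem_formSuperlevel (hΓ : IsAdmissibleCone Γ) {c R : ℝ}
    (hR : 0 < R) (hc : c ≤ f fun _ => R) :
    R • sqForm (realBasis n) ∈ formSuperlevel Γ f c := by
  rw [formSuperlevel, mem_ofPred_eq, complexForm_smul, complexForm_sqForm]
  exact smul_one_mem_diagonalSet ⟨subset_closure (hΓ.mem_of_pos fun _ => hR), hc⟩

end ComplexHessian

/-! ### Smooth approximation of a bounded subsolution -/

section Approximation

variable {n : ℕ} {Γ : Set (Fin n → ℝ)} {f : (Fin n → ℝ) → ℝ}

/-- A function touching a maximum from above touches whichever term attains it. The paraboloid makes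
the function real-valued and bounded below; the singleton lets the level `ψ z` depend on the point.
-/
lemma IsViscositySubsolution.hessianSubsolution (hΓ : IsAdmissibleCone Γ)
    (hf : IsAdmissibleFunction Γ f) {Ω : Set (EuclideanSpace ℂ (Fin n))}
    {ψ : EuclideanSpace ℂ (Fin n) → ℝ} {u : EuclideanSpace ℂ (Fin n) → EReal}
    (hu : IsViscositySubsolution Γ f Ω (fun z _ => ψ z) u) {R A : ℝ} (hR : 0 < R)
    (hψ : ∀ z ∈ Ω, ψ z ≤ f fun _ => R) (hΩ : IsOpen Ω) {z : EuclideanSpace ℂ (Fin n)}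
    (hz : z ∈ Ω) :
    HessianSubsolution (formSuperlevel Γ f (ψ z)) {z}
      fun y => (max (u y) ((R * ‖y - 0‖ ^ 2 + A : ℝ) : EReal)).toReal := by
  intro z' hz' q h1 h2 h3
  obtain rfl : z = z' := (mem_singleton_iff.1 hz').symm
  set p : EuclideanSpace ℂ (Fin n) → ℝ := fun y => R * ‖y - 0‖ ^ 2 + A with hp
  have hsq : ContDiff ℝ 2 fun y : EuclideanSpace ℂ (Fin n) => ‖y - 0‖ ^ 2 :=
    contDiff_sq_norm_sub norm_sq_eq_sum_realBasis 0
  have hp2 : ContDiff ℝ 2 p := (contDiff_const.mul hsq).add contDiff_const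
  have hcoe : ∀ y ∈ Ω, (((max (u y) (p y : EReal)).toReal : ℝ) : EReal) = max (u y) (p y) :=
    fun y hy => EReal.coe_toReal
      (max_lt (hu.1.1 y hy).lt_top (EReal.coe_lt_top _)).ne
      (lt_of_lt_of_le (EReal.bot_lt_coe _) (le_max_right _ _)).ne'
  have hq : ∀ᶠ y in 𝓝 z, max (u y) (p y) ≤ (q y : EReal) := by
    filter_upwards [h3, hΩ.mem_nhds hz] with y hy hyΩ
    rw [← hcoe y hyΩ]
    exact_mod_cast hy
  have hqz : max (u z) (p z) = (q z : EReal) := by rw [← hcoe z hz]; exact_mod_cast h2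
  rcases le_total (u z) (p z) with hle | hle
  · rw [max_eq_right hle] at hqz
    have hPSD := posSemidefForm_hessian_sub hp2.contDiffAt h1 (by exact_mod_cast hqz) (by
      filter_upwards [hq] with y hy
      exact_mod_cast (le_max_right _ _).trans hy)
    have e : hessian p z = R • sqForm (realBasis n) := by
      rw [hp, hessian_add_const (fun y => R * ‖y - 0‖ ^ 2), hessian_const_mul hsq.contDiffAt,
        hessian_sq_norm_sub norm_sq_eq_sum_realBasis]
    have h4 := add_mem_formSuperlevel hΓ hf _ (smul_sqForm_mem_formSuperlevel hΓ hR (hψ z hz)) _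
      hPSD
    rw [e] at h4
    have e2 : R • sqForm (realBasis n) + (hessian q z - R • sqForm (realBasis n)) =
        hessian q z := by ext v w; simp
    rwa [e2] at h4
  · rw [max_eq_left hle] at hqz
    have := hu.2 z hz q ⟨h1, hqz, by
      filter_upwards [hq] with y hy using (le_max_left _ _).trans hy⟩
    exact (le_hessianOperator_iff hΓ hf).1 this

open scoped Convolution in
/-- Smooth strict approximation from above of a bounded subsolution. -/
lemma exists_smooth_approximation (hΓ : IsAdmissibleCone Γ) (hf : IsAdmissibleFunction Γ f)
    {S K : Set (EuclideanSpace ℂ (Fin n))} (hK : IsCompact K) {η₀ : ℝ} (hη₀ : 0 < η₀)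
    (hSK : ∀ z ∈ S, Metric.ball z η₀ ⊆ K) {g ψ : EuclideanSpace ℂ (Fin n) → ℝ}
    (hg : UpperSemicontinuousOn g K) {m : ℝ} (hm : ∀ z ∈ K, m ≤ g z) (hψ : ContinuousOn ψ K)
    (hsub : ∀ z ∈ K, HessianSubsolution (formSuperlevel Γ f (ψ z)) {z} g)
    {R σ : ℝ} (hR : 0 < R) (hσ : σ < f fun _ => R) (hψσ : ∀ z ∈ K, ψ z ≤ σ) {d : ℝ} (hd : 0 < d) :
    ∃ w : EuclideanSpace ℂ (Fin n) → ℝ, ContDiff ℝ ∞ w ∧ (∀ z ∈ S, g z < w z) ∧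
      (∀ z ∈ S, ∃ y ∈ K, dist y z ≤ d ∧ w z ≤ g y + d) ∧
      ∀ z ∈ S, complexHessian w z ∈ coneMatrices Γ ∧
        (ψ z : EReal) ≤ hessianOperator Γ f (complexHessian w z) := by
  rcases S.eq_empty_or_nonempty with rfl | ⟨z₁, hz₁⟩
  · exact ⟨fun _ => 0, contDiff_const, by simp, by simp, by simp⟩
  have hSK' : ∀ z ∈ S, z ∈ K := fun z hz => hSK z hz (Metric.mem_ball_self hη₀)
  have hKne : K.Nonempty := ⟨z₁, hSK' z₁ hz₁⟩
  obtain ⟨wM, hwM, hM⟩ := hg.exists_isMaxOn hKne hK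
  obtain ⟨ρ, hρ⟩ := hK.isBounded.exists_norm_le
  set δ : ℝ := d / (4 * (ρ ^ 2 + 1)) with hδ_def
  have hδ : 0 < δ := by positivity
  have hδρ : ∀ z ∈ S, δ * ‖z - 0‖ ^ 2 ≤ d / 4 := fun z hz => by
    rw [sub_zero, hδ_def, div_mul_eq_mul_div, div_le_div_iff₀ (by positivity) (by positivity)]
    have := pow_le_pow_left₀ (norm_nonneg z) (hρ z (hSK' z hz)) 2
    nlinarith
  -- `τ` is the loss of level that adding `δ‖z‖²` will repair; below, `ω₁` is a distance over which
  -- `ψ` varies by less than `τ` on `K`.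
  obtain ⟨τ, hτ, hshift⟩ := hf.exists_shift hΓ hR hσ hδ
  obtain ⟨ω₁, hω₁, hψ₁⟩ := Metric.uniformContinuousOn_iff.1
    (hK.uniformContinuousOn_of_continuous hψ) τ hτ
  set η : ℝ := min (min η₀ ω₁) d / 4 with hη_def
  have hmin : 0 < min (min η₀ ω₁) d := lt_min (lt_min hη₀ hω₁) hd
  have hη : 0 < η := by positivity
  have hη1 : 4 * η ≤ η₀ := by
    have := (min_le_left (min η₀ ω₁) d).trans (min_le_left _ _); linarith
  have hη2 : 4 * η ≤ ω₁ := by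
    have := (min_le_left (min η₀ ω₁) d).trans (min_le_right _ _); linarith
  have hη3 : 4 * η ≤ d := by
    have := min_le_right (min η₀ ω₁) d; linarith
  have hmM : m ≤ g wM := hm wM hwM
  -- A maximiser `w` for `z` satisfies `‖z - w‖² ≤ ε (g wM - m) < η²`.
  set ε : ℝ := η ^ 2 / (g wM - m + 1) with hε_def
  have hε : 0 < ε := div_pos (by positivity) (by linarith)
  obtain ⟨v, hvc, hatt, hle⟩ := exists_supConvolution hK hKne hg hε
  have hgv : ∀ z ∈ K, g z ≤ v z := fun z hz => by simpa using hle z z hz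
  have hnear : ∀ z ∈ K, ∀ w ∈ K, v z = g w - ‖z - w‖ ^ 2 / ε → ‖z - w‖ < η := by
    intro z hz w hw h
    have h1 : ‖z - w‖ ^ 2 / ε ≤ g wM - m := by
      have := hgv z hz
      have := hm z hz
      have : g w ≤ g wM := hM hw
      linarith
    rw [div_le_iff₀ hε] at h1
    have h2 : (g wM - m) * ε < η ^ 2 := by
      rw [hε_def, mul_div_assoc', div_lt_iff₀ (by linarith)]
      nlinarith [pow_pos hη 2]
    exact lt_of_pow_lt_pow_left₀ 2 hη.le (h1.trans_lt h2)
  obtain ⟨ω₂, hω₂, hv₂⟩ := Metric.uniformContinuousOn_iff.1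
    (hK.uniformContinuousOn_of_continuous hvc.continuousOn) (d / 8) (by positivity)
  set ρ' : ℝ := min η ω₂ / 2 with hρ'_def
  have hρ' : 0 < ρ' := by have := lt_min hη hω₂; positivity
  have hρ'1 : ρ' < η := by have := lt_min hη hω₂; have := min_le_left η ω₂; linarith
  have hρ'2 : ρ' < ω₂ := by have := lt_min hη hω₂; have := min_le_right η ω₂; linarith
  let φ : ContDiffBump (0 : EuclideanSpace ℂ (Fin n)) := ⟨ρ' / 2, ρ', by positivity, by linarith⟩
  set μ : MeasureTheory.Measure (EuclideanSpace ℂ (Fin n)) := MeasureTheory.Measure.addHaar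
  set c := φ.normed μ ⋆[ContinuousLinearMap.lsmul ℝ ℝ, μ] v with hc_def
  have hc : ContDiff ℝ ∞ c := contDiff_convolution_normed μ φ hvc
  have hcv : ∀ z ∈ S, |c z - v z| ≤ d / 8 := by
    intro z hz
    rw [← Real.dist_eq]
    refine φ.dist_normed_convolution_le hvc.aestronglyMeasurable fun x hx => ?_
    have hx' : dist x z < ρ' := hx
    exact (hv₂ x (hSK z hz (Metric.mem_ball.2 (by linarith))) z (hSK' z hz) (by linarith)).le
  have hsq : ∀ {k : WithTop ℕ∞}, ContDiff ℝ k fun y : EuclideanSpace ℂ (Fin n) => ‖y - 0‖ ^ 2 :=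
    contDiff_sq_norm_sub norm_sq_eq_sum_realBasis 0
  have hhess : ∀ z ∈ S, complexForm (hessian c z) ∈ diagonalSet (superlevel Γ f (ψ z - τ)) := by
    intro z hz
    -- Near `z` the maximisers stay within `2η` of `z`, where `ψ > ψ z - τ`. Freezing this level
    -- yields the constant constraint that mollification requires.
    have hball : HessianSubsolution (formSuperlevel Γ f (ψ z - τ)) (Metric.ball z η) v := by
      refine HessianSubsolution.supConvolution (O := Metric.ball z η₀ ∩ Metric.ball z ω₁)
        hatt hle ?_ ?_
      · intro y hy q h1 h2 h3
        have hyK := hSK z hz hy.1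
        have h4 := hψ₁ y hyK z (hSK' z hz) hy.2
        rw [Real.dist_eq] at h4
        exact formSuperlevel_anti (by linarith [(abs_lt.1 h4).1])
          (hsub y hyK y rfl q h1 h2 h3)
      · intro y hy w hw h
        have hy' : dist y z < η := hy
        have hyK : y ∈ K := hSK z hz (Metric.mem_ball.2 (by linarith))
        have h1 := hnear y hyK w hw h
        rw [← dist_eq_norm, dist_comm] at h1
        have h2 : dist w z < 2 * η := by linarith [dist_triangle w y z]
        have h3 : w ∈ Metric.ball z η₀ := Metric.mem_ball.2 (by linarith)
        exact ⟨⟨h3, Metric.mem_ball.2 (by linarith)⟩,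
          Filter.mem_of_superset (Metric.isOpen_ball.mem_nhds h3) (hSK z hz)⟩
    exact hball.hessian_convolution_mem μ norm_sq_eq_sum_realBasis
      (convex_formSuperlevel hf _) (isClosed_formSuperlevel hf _)
      (add_mem_formSuperlevel hΓ hf)
      (smul_sqForm_mem_formSuperlevel hΓ hR (by linarith [hψσ z (hSK' z hz)])) hvc φ hρ'1
  have hH : ∀ z, complexHessian (fun y => c y + δ * ‖y - 0‖ ^ 2 + d / 4) z =
      complexForm (hessian c z) + δ • 1 := fun z => by
    rw [complexHessian_eq, hessian_add_const (fun y => c y + δ * ‖y - 0‖ ^ 2),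
      hessian_add (contDiff_infty.1 hc 2).contDiffAt (contDiff_const.mul hsq).contDiffAt,
      hessian_const_mul hsq.contDiffAt, hessian_sq_norm_sub norm_sq_eq_sum_realBasis,
      complexForm_add, complexForm_smul, complexForm_sqForm]
  -- The constant `d/4` beats the mollification error `d/8`, and the total excess is at most `d/8 +
  -- d/4 + d/4 < d`.
  refine ⟨fun y => c y + δ * ‖y - 0‖ ^ 2 + d / 4,
    (hc.add (contDiff_const.mul hsq)).add contDiff_const, fun z hz => ?_, fun z hz => ?_,
    fun z hz => ?_⟩
  · have h1 := abs_le.1 (hcv z hz)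
    have h2 := hgv z (hSK' z hz)
    have h3 : 0 ≤ δ * ‖z - 0‖ ^ 2 := by positivity
    linarith
  · obtain ⟨y, hyK, hy⟩ := hatt z
    have h1 := hnear z (hSK' z hz) y hyK hy
    rw [← dist_eq_norm, dist_comm] at h1
    have h2 := abs_le.1 (hcv z hz)
    have h3 := hδρ z hz
    have h4 : 0 ≤ ‖z - y‖ ^ 2 / ε := by positivity
    exact ⟨y, hyK, by linarith, by linarith⟩
  · rw [hH, coneMatrices_eq hΓ, le_hessianOperator_iff hΓ hf]
    refine ⟨add_smul_one_mem_diagonalSet (hhess z hz) fun x hx =>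
      hΓ.closure_add_mem hx.1 (hΓ.mem_of_pos fun _ => hδ),
      add_smul_one_mem_diagonalSet (hhess z hz) fun x hx =>
        ⟨hΓ.closure_add_nonneg hx.1 fun _ => hδ.le,
          hshift _ (hψσ z (hSK' z hz)) x hx.1 hx.2⟩⟩

end Approximation

/-! ### The two implications -/

section Equivalence

variable {n : ℕ} {Γ : Set (Fin n → ℝ)} {f : (Fin n → ℝ) → ℝ}

/-- Compactness and semicontinuity yield a uniform gap, so that an approximant of accuracy `d` for
`g` fits below the previous approximant `φ`. -/
lemma exists_pos_forall_add_lt {X : Type*} [PseudoMetricSpace X] {S K : Set X} (hS : IsCompact S)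
    (hSK : S ⊆ K) {g φ : X → ℝ} (hg : UpperSemicontinuousOn g K) (hφ : Continuous φ)
    (hlt : ∀ z ∈ S, g z < φ z) :
    ∃ d > 0, ∀ z ∈ S, ∀ y ∈ K, dist y z ≤ d → g y + d < φ z := by
  have key : ∀ᶠ t in 𝓝 (0 : ℝ), ∀ z ∈ S, ∀ y ∈ K, dist y z ≤ t → g y + t < φ z := by
    refine hS.eventually_forall_of_forall_eventually fun z hz => ?_
    set e := (φ z - g z) / 4 with he
    have he0 : 0 < e := by have := hlt z hz; linarith
    obtain ⟨r, hr, hgr⟩ := Metric.mem_nhdsWithin_iff.1 (hg z (hSK hz) (g z + e) (by linarith))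
    rw [nhds_prod_eq]
    filter_upwards [prod_mem_prod (Iio_mem_nhds (lt_min he0 (half_pos hr)))
      (inter_mem (hφ.continuousAt.preimage_mem_nhds
          (Ioi_mem_nhds (show φ z - e < φ z by linarith)))
        (Metric.ball_mem_nhds z (half_pos hr)))] with p hp y hyK hy
    have h1 : p.1 < e := (lt_min_iff.1 hp.1).1
    have h2 : p.1 < r / 2 := (lt_min_iff.1 hp.1).2
    have h3 : dist p.2 z < r / 2 := hp.2.2
    have h4 : g y < g z + e := hgr ⟨Metric.mem_ball.2 (by linarith [dist_triangle y p.2 z]), hyK⟩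
    have h5 : φ z - e < φ p.2 := hp.2.1
    linarith
  obtain ⟨d, hd, hd0⟩ := ((key.filter_mono nhdsWithin_le_nhds).and
    (self_mem_nhdsWithin : Ioi (0 : ℝ) ∈ 𝓝[>] 0)).exists
  exact ⟨d, hd0, hd⟩

variable {Ω : Set (EuclideanSpace ℂ (Fin n))} {ψ : EuclideanSpace ℂ (Fin n) → ℝ}
  {u : EuclideanSpace ℂ (Fin n) → EReal}

/-- Viscosity subsolutions are decreasing limits of smooth subsolutions on relatively compact open
subsets. -/
lemma IsViscositySubsolution.exists_antitone_approximation (hΓ : IsAdmissibleCone Γ)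
    (hf : IsAdmissibleFunction Γ f) (hΩ : IsOpen Ω) (hψ : ContinuousOn ψ Ω)
    (hu : IsViscositySubsolution Γ f Ω (fun z _ => ψ z) u) {R σ : ℝ} (hR : 0 < R)
    (hσ : σ < f fun _ => R) (hψσ : ∀ z ∈ Ω, ψ z ≤ σ) {S : Set (EuclideanSpace ℂ (Fin n))}
    (hS : IsCompact S) (hSΩ : S ⊆ Ω) :
    ∃ v : ℕ → EuclideanSpace ℂ (Fin n) → ℝ, (∀ j, ContDiff ℝ ∞ (v j)) ∧
      (∀ z ∈ S, Antitone fun j => v j z) ∧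
      (∀ z ∈ S, Tendsto (fun j => (v j z : EReal)) atTop (𝓝 (u z))) ∧
      ∀ j, ∀ z ∈ S, complexHessian (v j) z ∈ coneMatrices Γ ∧
        (ψ z : EReal) ≤ hessianOperator Γ f (complexHessian (v j) z) := by
  obtain ⟨η₀, hη₀, hKΩ⟩ := hS.exists_cthickening_subset_open hΩ hSΩ
  set K := Metric.cthickening η₀ S with hK_def
  have hK : IsCompact K := hS.cthickening
  have hSK : ∀ z ∈ S, Metric.ball z η₀ ⊆ K := fun z hz y hy =>
    Metric.mem_cthickening_of_dist_le y z η₀ S hz (Metric.mem_ball.1 hy).le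
  have hSK' : S ⊆ K := Metric.self_subset_cthickening S
  obtain ⟨ρ, hρ⟩ := hK.isBounded.exists_norm_le
  set p : ℕ → EuclideanSpace ℂ (Fin n) → ℝ := fun j y => R * ‖y - 0‖ ^ 2 + -(j : ℝ) with hp
  set w : ℕ → EuclideanSpace ℂ (Fin n) → ℝ := fun j y => (max (u y) (p j y : EReal)).toReal
    with hw
  have hcoe : ∀ j, ∀ y ∈ Ω, ((w j y : ℝ) : EReal) = max (u y) (p j y) :=
    fun j y hy => EReal.coe_toReal
      (max_lt (hu.1.1 y hy).lt_top (EReal.coe_lt_top _)).ne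
      (lt_of_lt_of_le (EReal.bot_lt_coe _) (le_max_right _ _)).ne'
  have hwlt : ∀ j, ∀ y ∈ Ω, ∀ t : ℝ, w j y < t ↔ u y < t ∧ p j y < t := fun j y hy t => by
    rw [← EReal.coe_lt_coe_iff, hcoe j y hy, max_lt_iff, EReal.coe_lt_coe_iff]
  have hwusc : ∀ j, UpperSemicontinuousOn (w j) K := by
    intro j z hz t ht
    obtain ⟨h1, h2⟩ := (hwlt j z (hKΩ hz) t).1 ht
    have hpc : Continuous (p j) := by fun_prop
    filter_upwards [(hu.1.2.mono hKΩ) z hz t h1, self_mem_nhdsWithin,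
      nhdsWithin_le_nhds (hpc.continuousAt.eventually_lt_const h2)] with y h3 h4 h5
    exact (hwlt j y (hKΩ h4) t).2 ⟨h3, h5⟩
  have hwle : ∀ j, ∀ z ∈ S, w (j + 1) z ≤ w j z := by
    intro j z hz
    rw [← EReal.coe_le_coe_iff, hcoe _ z (hSΩ hz), hcoe _ z (hSΩ hz)]
    refine max_le_max le_rfl (EReal.coe_le_coe_iff.2 ?_)
    simp only [hp]; push_cast; linarith
  have hwge : ∀ j : ℕ, ∀ z ∈ K, -(j : ℝ) ≤ w j z := by
    intro j z hz
    rw [← EReal.coe_le_coe_iff, hcoe _ z (hKΩ hz)]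
    refine le_trans (EReal.coe_le_coe_iff.2 ?_) (le_max_right _ _)
    have : 0 ≤ R * ‖z - 0‖ ^ 2 := by positivity
    simp only [hp]; linarith
  have happ : ∀ (j : ℕ) (d : ℝ), 0 < d → _ := fun j d hd =>
    exists_smooth_approximation hΓ hf hK hη₀ hSK (hwusc j) (hwge j) (hψ.mono hKΩ)
      (fun z hz => hu.hessianSubsolution hΓ hf hR (fun y hy => (hψσ y hy).trans hσ.le) hΩ (hKΩ hz))
      hR hσ (fun z hz => hψσ z (hKΩ hz)) hd
  let Good : ℕ → (EuclideanSpace ℂ (Fin n) → ℝ) → Prop := fun j v =>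
    ContDiff ℝ ∞ v ∧ (∀ z ∈ S, w j z < v z) ∧
      (∀ z ∈ S, ∃ y ∈ K, dist y z ≤ 1 / ((j : ℝ) + 1) ∧ v z ≤ w j y + 1 / ((j : ℝ) + 1)) ∧
      ∀ z ∈ S, complexHessian v z ∈ coneMatrices Γ ∧
        (ψ z : EReal) ≤ hessianOperator Γ f (complexHessian v z)
  obtain ⟨v₀, hv₀⟩ : ∃ v, Good 0 v := happ 0 _ (by positivity)
  -- The previous approximant lies strictly above `w j ≥ w (j + 1)` on `S`; the accuracy of the next
  -- one is taken below that gap.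
  have hstep : ∀ j (v : {v // Good j v}), ∃ v' : {v' // Good (j + 1) v'},
      ∀ z ∈ S, v'.1 z ≤ v.1 z := by
    rintro j ⟨v, hv1, hv2, -, -⟩
    obtain ⟨d, hd, hdlt⟩ := exists_pos_forall_add_lt hS hSK' (hwusc (j + 1)) hv1.continuous
      fun z hz => (hwle j z hz).trans_lt (hv2 z hz)
    have hj : 0 < 1 / (((j + 1 : ℕ) : ℝ) + 1) := by positivity
    obtain ⟨v', h1, h2, h3, h4⟩ := happ (j + 1) (min d (1 / (((j + 1 : ℕ) : ℝ) + 1)))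
      (lt_min hd hj)
    refine ⟨⟨v', h1, h2, fun z hz => ?_, h4⟩, fun z hz => ?_⟩
    · obtain ⟨y, hy, hy1, hy2⟩ := h3 z hz
      exact ⟨y, hy, hy1.trans (min_le_right _ _), hy2.trans (by gcongr; exact min_le_right _ _)⟩
    · obtain ⟨y, hy, hy1, hy2⟩ := h3 z hz
      have h5 := hdlt z hz y hy (hy1.trans (min_le_left _ _))
      have h6 := min_le_left d (1 / (((j + 1 : ℕ) : ℝ) + 1))
      change v' z ≤ v z
      linarith
  choose next hnext using hstep
  let seq : ∀ j, {v // Good j v} := fun j => Nat.rec ⟨v₀, hv₀⟩ (fun j v => next j v) j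
  have hgood : ∀ j, Good j (seq j).1 := fun j => (seq j).2
  refine ⟨fun j => (seq j).1, fun j => (hgood j).1, fun z hz => ?_, fun z hz => ?_,
    fun j => (hgood j).2.2.2⟩
  · exact antitone_nat_of_succ_le fun j => hnext j (seq j) z hz
  · refine tendsto_order.2 ⟨fun a ha => Eventually.of_forall fun j => ha.trans_le ?_,
      fun a ha => ?_⟩
    · refine le_trans ?_ (EReal.coe_le_coe_iff.2 ((hgood j).2.1 z hz).le)
      rw [hcoe j z (hSΩ hz)]
      exact le_max_left _ _
    -- The value at `z` is at most `w j y + 1/(j+1)` for some `y` within `1/(j+1)` of `z`. There `u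
    -- y < t'` by semicontinuity, and `p j < t'` on `K` once `j` is large; this covers `u z = -∞`
    -- too.
    · obtain ⟨t, hut, hta⟩ := EReal.lt_iff_exists_real_btwn.1 ha
      obtain ⟨t', hut', htt⟩ := EReal.lt_iff_exists_real_btwn.1 hut
      rw [EReal.coe_lt_coe_iff] at htt
      obtain ⟨r, hr, hur⟩ := Metric.mem_nhdsWithin_iff.1 (hu.1.2 z (hSΩ hz) t' hut')
      have h1 : ∀ᶠ j : ℕ in atTop, 1 / ((j : ℝ) + 1) < min r (t - t') :=
        tendsto_one_div_add_atTop_nhds_zero_nat.eventually_lt_const (lt_min hr (by linarith))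
      have h2 : ∀ᶠ j : ℕ in atTop, R * ρ ^ 2 - t' < j :=
        tendsto_natCast_atTop_atTop.eventually_gt_atTop _
      filter_upwards [h1, h2] with j h3 h4
      obtain ⟨y, hy, hy1, hy2⟩ := (hgood j).2.2.1 z hz
      have h5 := lt_min_iff.1 h3
      have h6 : u y < t' := hur ⟨Metric.mem_ball.2 (hy1.trans_lt h5.1), hKΩ hy⟩
      have h7 : p j y < t' := by
        have h8 := pow_le_pow_left₀ (norm_nonneg y) (hρ y hy) 2
        have h9 := mul_le_mul_of_nonneg_left h8 hR.le
        simp only [hp, sub_zero]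
        linarith
      have h8 := (hwlt j y (hKΩ hy) t').2 ⟨h6, h7⟩
      refine lt_trans (EReal.coe_lt_coe_iff.2 ?_) hta
      linarith [h5.2]

/-- Decreasing limits of smooth subsolutions are viscosity subsolutions. -/
lemma isViscositySubsolution_of_antitone_approximation (hΓ : IsAdmissibleCone Γ)
    (hf : IsAdmissibleFunction Γ f) (hΩ : IsOpen Ω) (hψ : ContinuousOn ψ Ω) (hu : IsUSC Ω u)
    (happ : ∀ U : Set (EuclideanSpace ℂ (Fin n)), IsOpen U → IsCompact (closure U) →
      closure U ⊆ Ω → ∃ v : ℕ → EuclideanSpace ℂ (Fin n) → ℝ,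
        (∀ j, ContDiffOn ℝ 2 (v j) U) ∧ (∀ z ∈ U, Antitone fun j => v j z) ∧
        (∀ z ∈ U, Tendsto (fun j => (v j z : EReal)) atTop (𝓝 (u z))) ∧
        (∀ j, ∀ z ∈ U, (ψ z : EReal) ≤ hessianOperator Γ f (complexHessian (v j) z))) :
    IsViscositySubsolution Γ f Ω (fun z _ => ψ z) u := by
  refine ⟨hu, fun z₀ hz₀ q ⟨hq, huq, hle⟩ => ?_⟩
  -- A level `c < ψ z₀` is fixed: it stays below `ψ` near `z₀`, so a single closed constraint set
  -- suffices.
  refine le_of_forall_lt fun a ha => ?_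
  obtain ⟨c, hac, hc⟩ := EReal.lt_iff_exists_real_btwn.1 ha
  refine hac.trans_le ?_
  rw [EReal.coe_lt_coe_iff] at hc
  rw [complexHessian_eq, le_hessianOperator_iff hΓ hf]
  change hessian q z₀ ∈ formSuperlevel Γ f c
  have hclosed := isClosed_formSuperlevel (Γ := Γ) hf c
  have hsq : ContDiff ℝ 2 fun y : EuclideanSpace ℂ (Fin n) => ‖y - z₀‖ ^ 2 :=
    contDiff_sq_norm_sub norm_sq_eq_sum_realBasis z₀
  have key : ∀ ε : ℝ, 0 < ε → ∃ᶠ z in 𝓝 z₀,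
      hessian q z + ε • sqForm (realBasis n) ∈ formSuperlevel Γ f c := by
    intro ε hε
    rw [Filter.frequently_iff]
    intro N hN
    have hψ0 : ∀ᶠ z in 𝓝 z₀, c < ψ z :=
      (hψ.continuousAt (hΩ.mem_nhds hz₀)).eventually_const_lt hc
    obtain ⟨r, hr, hball⟩ := Metric.nhds_basis_closedBall.eventually_iff.1
      (((hΩ.eventually_mem hz₀).and hle).and
        ((hq.eventually (by simp)).and (hψ0.and (eventually_mem_set.2 hN))))
    obtain ⟨v, hv1, hv2, hv3, hv4⟩ := happ (Metric.ball z₀ r) Metric.isOpen_ball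
      ((isCompact_closedBall z₀ r).of_isClosed_subset isClosed_closure
        Metric.closure_ball_subset_closedBall)
      (Metric.closure_ball_subset_closedBall.trans fun z hz => (hball hz).1.1)
    set s := r / 2 with hs
    have hs0 : 0 < s := by positivity
    have hsr : s < r := by linarith
    have hin : Metric.closedBall z₀ s ⊆ Metric.ball z₀ r := Metric.closedBall_subset_ball hsr
    have hvc : ∀ j, ∀ z ∈ Metric.ball z₀ r, ContDiffAt ℝ 2 (v j) z := fun j z hz =>
      (hv1 j).contDiffAt (Metric.isOpen_ball.mem_nhds hz)
    have hqc : ∀ z ∈ Metric.ball z₀ r, ContDiffAt ℝ 2 q z := fun z hz =>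
      (hball (Metric.ball_subset_closedBall hz)).2.1
    have hφc : ∀ j, ContinuousOn (fun z => v j z - q z - ε * ‖z - z₀‖ ^ 2)
        (Metric.closedBall z₀ s) := fun j z hz =>
      (((hvc j z (hin hz)).continuousAt.sub (hqc z (hin hz)).continuousAt).sub
        (continuousAt_const.mul hsq.continuous.continuousAt)).continuousWithinAt
    -- A Dini argument: otherwise the nested compact sets `C j` share a point, at which `u ≥ q +
    -- εs²/2`, contrary to `u ≤ q`.
    obtain ⟨j, hj⟩ : ∃ j, ∀ z ∈ Metric.sphere z₀ s,
        v j z - q z - ε * ‖z - z₀‖ ^ 2 ≤ -(ε * s ^ 2 / 2) := by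
      by_contra! hcon
      let C : ℕ → Set (EuclideanSpace ℂ (Fin n)) := fun j => Metric.sphere z₀ s ∩
        (fun z => v j z - q z - ε * ‖z - z₀‖ ^ 2) ⁻¹' Ici (-(ε * s ^ 2 / 2))
      have hCclosed : ∀ j, IsClosed (C j) := fun j =>
        ((hφc j).mono Metric.sphere_subset_closedBall).preimage_isClosed_of_isClosed
          Metric.isClosed_sphere isClosed_Ici
      obtain ⟨z, hz⟩ := IsCompact.nonempty_iInter_of_sequence_nonempty_isCompact_isClosed C
        (fun j z hz => ⟨hz.1, by
          have h1 := hv2 z (hin (Metric.sphere_subset_closedBall hz.1)) (Nat.le_succ j)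
          have h2 : -(ε * s ^ 2 / 2) ≤ v (j + 1) z - q z - ε * ‖z - z₀‖ ^ 2 := hz.2
          change -(ε * s ^ 2 / 2) ≤ v j z - q z - ε * ‖z - z₀‖ ^ 2
          dsimp only [Nat.succ_eq_add_one] at h1
          linarith⟩)
        (fun j => let ⟨z, hz, hlt⟩ := hcon j; ⟨z, hz, hlt.le⟩)
        ((isCompact_sphere z₀ s).of_isClosed_subset (hCclosed 0) inter_subset_left) hCclosed
      rw [mem_iInter] at hz
      have hzs : z ∈ Metric.sphere z₀ s := (hz 0).1
      have hzr := hin (Metric.sphere_subset_closedBall hzs)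
      have h1 : ((q z + ε * s ^ 2 / 2 : ℝ) : EReal) ≤ u z := by
        refine ge_of_tendsto (hv3 z hzr) (Eventually.of_forall fun j => ?_)
        have h2 : -(ε * s ^ 2 / 2) ≤ v j z - q z - ε * ‖z - z₀‖ ^ 2 := (hz j).2
        rw [mem_sphere_iff_norm.1 hzs] at h2
        exact EReal.coe_le_coe_iff.2 (by linarith)
      have h2 := EReal.coe_le_coe_iff.1
        (h1.trans (hball (Metric.ball_subset_closedBall hzr)).1.2)
      have : 0 < ε * s ^ 2 := by positivity
      linarith
    -- At the centre the function is nonnegative because `v j ≥ u`, whereas it is negative on the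
    -- sphere.
    have hmax : ∃ z ∈ Metric.ball z₀ s,
        IsLocalMax (fun z => v j z - q z - ε * ‖z - z₀‖ ^ 2) z := by
      by_contra! hno
      have h1 := le_of_forall_sphere_of_not_isLocalMax (hφc j) hno hj z₀
        (Metric.mem_closedBall_self hs0.le)
      have h2 : u z₀ ≤ v j z₀ := Antitone.le_of_tendsto (f := fun j => (v j z₀ : EReal))
        (fun i k hik => EReal.coe_le_coe_iff.2 (hv2 z₀ (Metric.mem_ball_self hr) hik))
        (hv3 z₀ (Metric.mem_ball_self hr)) j
      rw [huq, EReal.coe_le_coe_iff] at h2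
      have : 0 < ε * s ^ 2 := by positivity
      simp only [sub_self, norm_zero, ne_eq, OfNat.ofNat_ne_zero, not_false_eq_true, zero_pow,
        mul_zero, sub_zero] at h1
      linarith
    obtain ⟨z, hz, hzmax⟩ := hmax
    have hzr := hin (Metric.ball_subset_closedBall hz)
    have hzb := hball (Metric.ball_subset_closedBall hzr)
    refine ⟨z, hzb.2.2.2, ?_⟩
    have hc1 : ContDiffAt ℝ 2 (fun z => ε * ‖z - z₀‖ ^ 2) z := contDiffAt_const.mul hsq.contDiffAt
    have hPSD := posSemidefForm_neg_hessian (((hvc j z hzr).sub (hqc z hzr)).sub hc1) hzmax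
    rw [hessian_sub (p := fun y => v j y - q y) ((hvc j z hzr).sub (hqc z hzr)) hc1,
      hessian_sub (hvc j z hzr) (hqc z hzr), hessian_const_mul hsq.contDiffAt,
      hessian_sq_norm_sub norm_sq_eq_sum_realBasis] at hPSD
    have hmem : hessian (v j) z ∈ formSuperlevel Γ f (ψ z) :=
      (le_hessianOperator_iff hΓ hf).1 (hv4 j z hzr)
    have := add_mem_formSuperlevel hΓ hf _ (formSuperlevel_anti hzb.2.2.1.le hmem) _ hPSD
    convert this using 1
    ext x y
    simp
    ring
  -- First `z → z₀` by continuity of the Hessian of `q`, then `ε → 0`.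
  have key2 : ∀ ε : ℝ, 0 < ε →
      hessian q z₀ + ε • sqForm (realBasis n) ∈ formSuperlevel Γ f c := fun ε hε =>
    hclosed.closure_eq ▸ mem_closure_of_frequently_of_tendsto (key ε hε)
      (tendsto_hessian_add hq _)
  exact hclosed.mem_of_tendsto (tendsto_add_smul_form _ (sqForm (realBasis n))) (by
    filter_upwards [self_mem_nhdsWithin] with ε hε using key2 ε hε)

end Equivalence

theorem corollary1p1 (n : ℕ) (hn : 1 ≤ n)
    (Γ : Set (Fin n → ℝ)) (hΓ : IsAdmissibleCone Γ)
    (f : (Fin n → ℝ) → ℝ) (hf : IsAdmissibleFunction Γ f)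
    (Ω : Set (EuclideanSpace ℂ (Fin n)))
    (hΩ_open : IsOpen Ω) (hΩ_conn : IsConnected Ω) (hΩ_bdd : Bornology.IsBounded Ω)
    (ψ : EuclideanSpace ℂ (Fin n) → ℝ)
    (hψ_cont : ContinuousOn ψ (closure Ω)) (hψ_nonneg : ∀ z ∈ closure Ω, 0 ≤ ψ z)
    -- `L ∈ [-∞, ∞]` is the limit of `f(R, …, R)` as `R → ∞`, which may be `∞`
    (L : EReal) (hL : Tendsto (fun R : ℝ => ((f fun _ => R : ℝ) : EReal)) atTop (𝓝 L))
    (hψL : (⨆ z ∈ Ω, (ψ z : EReal)) < L)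
    (u : EuclideanSpace ℂ (Fin n) → EReal) (hu : IsUSC Ω u) :
    IsViscositySubsolution Γ f Ω (fun z _ => ψ z) u ↔
      ∀ U : Set (EuclideanSpace ℂ (Fin n)), IsOpen U → IsCompact (closure U) → closure U ⊆ Ω →
        ∃ v : ℕ → EuclideanSpace ℂ (Fin n) → ℝ,
          (∀ j, IsSmoothGammaSubharmonicOn Γ U (v j)) ∧
          (∀ z ∈ U, Antitone fun j => v j z) ∧
          (∀ z ∈ U, Tendsto (fun j => (v j z : EReal)) atTop (𝓝 (u z))) ∧
          (∀ j, ∀ z ∈ U, (ψ z : EReal) ≤ hessianOperator Γ f (complexHessian (v j) z)) := by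
  have hψ : ContinuousOn ψ Ω := hψ_cont.mono subset_closure
  constructor
  · intro hvisc U _ hUc hUΩ
    obtain ⟨R, hRL, hR⟩ :=
      ((hL.eventually_const_lt hψL).and (eventually_gt_atTop (0 : ℝ))).exists
    -- A real level strictly between `sup ψ` and `f(R,…,R)` supplies the uniform gap used by
    -- `exists_shift`.
    obtain ⟨σ, hσ1, hσ2⟩ := EReal.lt_iff_exists_real_btwn.1 hRL
    obtain ⟨v, hv1, hv2, hv3, hv4⟩ := hvisc.exists_antitone_approximation hΓ hf hΩ_open hψ hR
      (EReal.coe_lt_coe_iff.1 hσ2)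
      (fun z hz => EReal.coe_le_coe_iff.1 ((le_biSup (fun z => (ψ z : EReal)) hz).trans hσ1.le))
      hUc hUΩ
    exact ⟨v, fun j => ⟨(hv1 j).contDiffOn, fun z hz => (hv4 j z (subset_closure hz)).1⟩,
      fun z hz => hv2 z (subset_closure hz), fun z hz => hv3 z (subset_closure hz),
      fun j z hz => (hv4 j z (subset_closure hz)).2⟩
  · intro h
    refine isViscositySubsolution_of_antitone_approximation hΓ hf hΩ_open hψ hu
      fun U hU hUc hUΩ => ?_
    obtain ⟨v, hv1, hv2, hv3, hv4⟩ := h U hU hUc hUΩ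
    exact ⟨v, fun j => contDiffOn_infty.1 (hv1 j).1 2, hv2, hv3, hv4⟩
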